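/- Let $\Omega=(0,L_1)\times(0,L_2)$ with $L_1,L_2>0$, and let $T>0$, $\gamma\ge 0$, $\epsilon>0$, $\alpha>0$, $0<p<q$. For $s\ge 0$ let $\Phi$ be one of $$\Phi_1(s)=\alpha\,\frac{q-p}{(p+s)(q+s)},\qquad \Phi_2(s)=\frac{\alpha}{q+(p+q)s/p}.$$ $H^m_{per}(\Omega)$ denotes the $\Omega$-periodic Sobolev space, with norm $\|u\|_{H^m(\Omega)}=\big(\sum_{|\beta|\le m}\|\partial^\beta u\|^2\big)^{1/2}$, where $\|\cdot\|$ is the $L^2(\Omega)$ norm; $H^{-2}_{per}(\Omega)$ is the dual of $H^2_{per}(\Omega)$; and $\langle\cdot,\cdot\rangle$ is the $L^2(\Omega)$ inner product or the duality pairing. Put $$a(h,\phi)=\gamma\langle\nabla h,\nabla\phi\rangle+\epsilon^2\langle\Delta h,\Delta\phi\rangle-\langle\Phi(|\nabla h|)\nabla h,\nabla\phi\rangle .$$ For $N\ge 1$ let $\mathcal I_N$ be either $\{\xi\in\mathbb Z^2: 0\le\xi_1,\xi_2\le N,\ \xi\ne 0\}$ for all $N$, or $\{\xi\in\mathbb Z^2: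 |\xi_1|,|\xi_2|\le N,\ \xi\neq 0\}$ for all $N$. Let $$H_N=\mathrm{span}\{1,\cos \xi\cdot\tilde x,\ \sin\xi\cdot\tilde x:\ \xi\in\mathcal I_N\},\qquad \tilde x=2\pi(x_1/L_1,x_2/L_2),$$ and let $P_N$ be the $L^2(\Omega)$-orthogonal projection onto $H_N$. For $h_0\in L^2(\Omega)$ and $\zeta\in L^2(0,T;H^{-2}_{per}(\Omega))$, a semi-discrete Galerkin approximation is an absolutely continuous $h_N:[0,T]\to H_N$ with $h_N(0)=P_Nh_0$ such that, for almost every $t\in(0,T)$, $$\langle\partial_t h_N,\phi\rangle+a(h_N,\phi)=\langle\zeta,\phi\rangle\qquad\text{for all }\phi\in H_N .$$ Then: 1. For every $N\ge1$, $h_0\in L^2(\Omega)$ and $\zeta\in L^2(0,T;H^{-2}_{per}(\Omega))$ there exists exactly one semi-discrete Galerkin approximation $h_N$ on $[0,T]$. 2. There is a function $C:\mathbb{R}^2\to(0,\infty)$, depending only on the fixed data $L_1,L_2,T,\gamma,\epsilon,\alpha,p,q$, the choice of $\Phi$ and the choice of the family $(\mathcal I_N)_N$ (in particular, not on $N$,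 $h_0$, $\zeta$), such that for all $N\ge1$ and all $h_0\in L^2(\Omega)$, $\zeta\in L^2(0,T;H^{-2}_{per}(\Omega))$, one has $h_N\in L^\infty(0,T;L^2(\Omega))\cap L^2(0,T;H^2_{per}(\Omega))$ and $$\|h_N\|_{L^\infty(0,T;L^2(\Omega))}+\|h_N\|_{L^2(0,T;H^2(\Omega))}\le C\big(\|h_0\|,\|\zeta\|_{L^2(0,T;H^{-2}_{per}(\Omega))}\big).$$ 3. There is likewise a function $C:\mathbb{R}^2\to(0,\infty)$, depending only on the same fixed data, such that for all $N\ge 1$ and all $h_0\in H^2_{per}(\Omega)$, $\zeta\in L^2(0,T;L^2(\Omega))$, one has $h_N\in L^\infty(0,T;H^2_{per}(\Omega))\cap L^2(0,T;H^4_{per}(\Omega))$, $\partial_th_N\in L^2(0,T;L^2(\Omega))$ and $$\|h_N\|_{L^\infty(0,T;H^2(\Omega))}+\|h_N\|_{L^2(0,T;H^4(\Omega))}+\|\partial_th_N\|_{L^2(0,T;L^2(\Omega))}\le C\big(\|h_0\|_{H^2(\Omega)},\|\zeta\|_{L^2(0,T;L^2(\Omega))}\big).$$ -/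

import Mathlib

open MeasureTheory Set
open scoped ContDiff ENNReal

noncomputable section

namespace ThinFilm

/-! ### Smooth periodic functions on the rectangle -/

/-- Smooth real functions on the plane that are periodic with respect to the rectangle
`(0, L₁) × (0, L₂)`. -/
def PerSmooth (L₁ L₂ : ℝ) : Submodule ℝ (ℝ × ℝ → ℝ) where
  carrier := {f | ContDiff ℝ ∞ f ∧ ∀ x, f (x + (L₁, 0)) = f x ∧ f (x + (0, L₂)) = f x}
  add_mem' := fun {f g} hf hg => ⟨hf.1.add hg.1, fun x => by
    constructor
    · simp only [Pi.add_apply]; rw [(hf.2 x).1, (hg.2 x).1]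
    · simp only [Pi.add_apply]; rw [(hf.2 x).2, (hg.2 x).2]⟩
  zero_mem' := ⟨contDiff_const, fun _ => ⟨rfl, rfl⟩⟩
  smul_mem' := fun c f hf => ⟨contDiff_const.smul hf.1, fun x => by
    constructor
    · simp only [Pi.smul_apply]; rw [(hf.2 x).1]
    · simp only [Pi.smul_apply]; rw [(hf.2 x).2]⟩

variable {L₁ L₂ : ℝ}

theorem perDiff (f : PerSmooth L₁ L₂) : Differentiable ℝ f.1 :=
  f.2.1.differentiable (by simp)

theorem fderiv_periodic {f : ℝ × ℝ → ℝ} {c : ℝ × ℝ} (h : ∀ x, f (x + c) = f x) (x : ℝ × ℝ) :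
    fderiv ℝ f (x + c) = fderiv ℝ f x := by
  have h1 : (fun y => f (y + c)) = f := funext h
  rw [← fderiv_comp_add_right c, h1]

/-- The directional derivative `∂_e`. -/
def pd (e : ℝ × ℝ) : PerSmooth L₁ L₂ →ₗ[ℝ] PerSmooth L₁ L₂ where
  toFun f := ⟨fun x => fderiv ℝ f.1 x e, by
    refine ⟨(f.2.1.fderiv_right (m := ∞) (by simp)).clm_apply contDiff_const, fun x => ⟨?_, ?_⟩⟩
    · beta_reduce; rw [fderiv_periodic fun y => (f.2.2 y).1]
    · beta_reduce; rw [fderiv_periodic fun y => (f.2.2 y).2]⟩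
  map_add' f g := by
    ext x
    change fderiv ℝ (f.1 + g.1) x e = fderiv ℝ f.1 x e + fderiv ℝ g.1 x e
    rw [fderiv_add (perDiff f x) (perDiff g x)]; rfl
  map_smul' c f := by
    ext x
    change fderiv ℝ (c • f.1) x e = c * fderiv ℝ f.1 x e
    rw [fderiv_const_smul (perDiff f x)]; rfl

/-- `∂₁`. -/
def pd₁ : PerSmooth L₁ L₂ →ₗ[ℝ] PerSmooth L₁ L₂ := pd (1, 0)

/-- `∂₂`. -/
def pd₂ : PerSmooth L₁ L₂ →ₗ[ℝ] PerSmooth L₁ L₂ := pd (0, 1)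

/-- The derivative `∂^α = ∂₁^α₁ ∂₂^α₂`. -/
def D (α : ℕ × ℕ) : PerSmooth L₁ L₂ →ₗ[ℝ] PerSmooth L₁ L₂ := pd₁ ^ α.1 * pd₂ ^ α.2

/-- The Laplacian. -/
def lap : PerSmooth L₁ L₂ →ₗ[ℝ] PerSmooth L₁ L₂ := D (2, 0) + D (0, 2)

/-- The Euclidean length of the gradient. -/
def gradNorm (f : PerSmooth L₁ L₂) (x : ℝ × ℝ) : ℝ :=
  Real.sqrt ((pd₁ f).1 x ^ 2 + (pd₂ f).1 x ^ 2)

/-- The inner product of two gradients. -/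
def gradDot (f g : PerSmooth L₁ L₂) (x : ℝ × ℝ) : ℝ :=
  (pd₁ f).1 x * (pd₁ g).1 x + (pd₂ f).1 x * (pd₂ g).1 x

/-! ### The spaces `L²(Ω)` and `H^m_per(Ω)` -/

/-- Lebesgue measure on `Ω = (0, L₁) × (0, L₂)`. -/
def boxMeasure (L₁ L₂ : ℝ) : Measure (ℝ × ℝ) := volume.restrict (Ioo 0 L₁ ×ˢ Ioo 0 L₂)

instance : IsFiniteMeasure (boxMeasure L₁ L₂) := by
  refine ⟨?_⟩
  rw [boxMeasure, Measure.restrict_apply_univ, Measure.volume_eq_prod, Measure.prod_prod]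
  exact ENNReal.mul_lt_top (by simp) (by simp)

/-- `L²(Ω)`. -/
abbrev L2 (L₁ L₂ : ℝ) : Type := Lp ℝ 2 (boxMeasure L₁ L₂)

theorem integrable_of_continuous {f : ℝ × ℝ → ℝ} (hf : Continuous f) :
    IntegrableOn f (Icc 0 L₁ ×ˢ Icc 0 L₂) :=
  hf.continuousOn.integrableOn_compact (isCompact_Icc.prod isCompact_Icc)

theorem perMemLp (f : PerSmooth L₁ L₂) : MemLp f.1 2 (boxMeasure L₁ L₂) := by
  have hc : Continuous f.1 := f.2.1.continuous
  obtain ⟨C, hC⟩ := (isCompact_Icc.prod isCompact_Icc : IsCompact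
    (Icc (0 : ℝ) L₁ ×ˢ Icc (0 : ℝ) L₂)).exists_bound_of_continuousOn hc.continuousOn
  refine MemLp.of_bound hc.aestronglyMeasurable C ?_
  refine (ae_restrict_iff' (measurableSet_Ioo.prod measurableSet_Ioo)).2 (.of_forall ?_)
  exact fun x hx => hC x (prod_mono Ioo_subset_Icc_self Ioo_subset_Icc_self hx)

/-- The class in `L²(Ω)` of a smooth periodic function. -/
def toL2 : PerSmooth L₁ L₂ →ₗ[ℝ] L2 L₁ L₂ where
  toFun f := (perMemLp f).toLp f.1
  map_add' f g := (perMemLp f).toLp_add (perMemLp g)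
  map_smul' c f := (perMemLp f).toLp_const_smul c

theorem inner_toL2 (f g : PerSmooth L₁ L₂) :
    inner ℝ (toL2 f) (toL2 g) = ∫ x in Ioo 0 L₁ ×ˢ Ioo 0 L₂, f.1 x * g.1 x := by
  rw [L2.inner_def]
  refine integral_congr_ae ?_
  filter_upwards [(perMemLp f).coeFn_toLp, (perMemLp g).coeFn_toLp] with x h1 h2
  change inner ℝ (((perMemLp f).toLp f.1 : L2 L₁ L₂) x) (((perMemLp g).toLp g.1 : L2 L₁ L₂) x) = _
  rw [h1, h2]
  simp [mul_comm]

theorem integral_box_eq {F : ℝ × ℝ → ℝ} (hF : Continuous F) (h₁ : 0 ≤ L₁) (h₂ : 0 ≤ L₂) :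
    ∫ x in Ioo 0 L₁ ×ˢ Ioo 0 L₂, F x = ∫ x in (0)..L₁, ∫ y in (0)..L₂, F (x, y) := by
  have hi : IntegrableOn F (Ioo 0 L₁ ×ˢ Ioo 0 L₂) (volume.prod volume) :=
    (integrable_of_continuous hF).mono_set (prod_mono Ioo_subset_Icc_self Ioo_subset_Icc_self)
  rw [Measure.volume_eq_prod, setIntegral_prod _ hi, intervalIntegral.integral_of_le h₁,
    integral_Ioc_eq_integral_Ioo]
  refine integral_congr_ae (.of_forall fun x => ?_)
  change _ = ∫ y in (0)..L₂, F (x, y)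
  rw [intervalIntegral.integral_of_le h₂, integral_Ioc_eq_integral_Ioo]

theorem box_empty (h : ¬(0 ≤ L₁ ∧ 0 ≤ L₂)) : Ioo 0 L₁ ×ˢ Ioo 0 L₂ = (∅ : Set (ℝ × ℝ)) := by
  rw [prod_eq_empty_iff]
  rw [not_and_or] at h
  exact h.imp (fun h => Ioo_eq_empty (by linarith)) (fun h => Ioo_eq_empty (by linarith))

theorem integral_pd₁ (f : PerSmooth L₁ L₂) :
    ∫ x in Ioo 0 L₁ ×ˢ Ioo 0 L₂, (pd₁ f).1 x = 0 := by
  by_cases h : 0 ≤ L₁ ∧ 0 ≤ L₂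
  swap
  · simp [box_empty h]
  have hF : Continuous (pd₁ f).1 := (pd₁ f).2.1.continuous
  have hs : ∫ x in (0)..L₁, ∫ y in (0)..L₂, (pd₁ f).1 (x, y) =
      ∫ y in (0)..L₂, ∫ x in (0)..L₁, (pd₁ f).1 (x, y) := by
    refine intervalIntegral_intervalIntegral_swap
      (F := fun x y => (pd₁ f).1 (x, y)) ((integrable_of_continuous (L₁ := L₁) (L₂ := L₂) hF).mono_set ?_)
    rw [uIoc_of_le h.1, uIoc_of_le h.2]
    exact prod_mono Ioc_subset_Icc_self Ioc_subset_Icc_self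
  rw [integral_box_eq hF h.1 h.2, hs]
  have key : ∀ y : ℝ, ∫ x in (0)..L₁, (pd₁ f).1 (x, y) = 0 := fun y => by
    have hd : ∀ x ∈ uIcc 0 L₁, HasDerivAt (fun x => f.1 (x, y)) ((pd₁ f).1 (x, y)) x :=
      fun x _ => (perDiff f (x, y)).hasFDerivAt.comp_hasDerivAt x
        ((hasDerivAt_id x).prodMk (hasDerivAt_const x y))
    rw [intervalIntegral.integral_eq_sub_of_hasDerivAt hd
      ((hF.comp (by fun_prop : Continuous fun x : ℝ => (x, y))).intervalIntegrable _ _)]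
    have := (f.2.2 (0, y)).1
    simp only [Prod.mk_add_mk, zero_add, add_zero] at this
    rw [this, sub_self]
  simp [key]

theorem integral_pd₂ (f : PerSmooth L₁ L₂) :
    ∫ x in Ioo 0 L₁ ×ˢ Ioo 0 L₂, (pd₂ f).1 x = 0 := by
  by_cases h : 0 ≤ L₁ ∧ 0 ≤ L₂
  swap
  · simp [box_empty h]
  have hF : Continuous (pd₂ f).1 := (pd₂ f).2.1.continuous
  rw [integral_box_eq hF h.1 h.2]
  have key : ∀ x : ℝ, ∫ y in (0)..L₂, (pd₂ f).1 (x, y) = 0 := fun x => by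
    have hd : ∀ y ∈ uIcc 0 L₂, HasDerivAt (fun y => f.1 (x, y)) ((pd₂ f).1 (x, y)) y :=
      fun y _ => (perDiff f (x, y)).hasFDerivAt.comp_hasDerivAt y
        ((hasDerivAt_const y x).prodMk (hasDerivAt_id y))
    rw [intervalIntegral.integral_eq_sub_of_hasDerivAt hd
      ((hF.comp (by fun_prop : Continuous fun y : ℝ => (x, y))).intervalIntegrable _ _)]
    have := (f.2.2 (x, 0)).2
    simp only [Prod.mk_add_mk, zero_add, add_zero] at this
    rw [this, sub_self]
  simp [key]

/-- The product of two smooth periodic functions. -/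
def perMul (f g : PerSmooth L₁ L₂) : PerSmooth L₁ L₂ :=
  ⟨fun x => f.1 x * g.1 x, f.2.1.mul g.2.1, fun x =>
    ⟨by beta_reduce; rw [(f.2.2 x).1, (g.2.2 x).1], by beta_reduce; rw [(f.2.2 x).2, (g.2.2 x).2]⟩⟩

theorem pd_mul_apply (e : ℝ × ℝ) (f g : PerSmooth L₁ L₂) (x : ℝ × ℝ) :
    (pd e (perMul f g)).1 x = f.1 x * (pd e g).1 x + (pd e f).1 x * g.1 x := by
  change fderiv ℝ (fun x => f.1 x * g.1 x) x e = _
  rw [fderiv_fun_mul (perDiff f x) (perDiff g x)]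
  change f.1 x * _ + g.1 x * _ = _
  rw [mul_comm (g.1 x)]; rfl

theorem inner_pd_of_integral (e : ℝ × ℝ)
    (he : ∀ f : PerSmooth L₁ L₂, ∫ x in Ioo 0 L₁ ×ˢ Ioo 0 L₂, (pd e f).1 x = 0)
    (f g : PerSmooth L₁ L₂) :
    inner ℝ (toL2 f) (toL2 (pd e g)) = -inner ℝ (toL2 (pd e f)) (toL2 g) := by
  have h := he (perMul f g)
  simp only [pd_mul_apply] at h
  have hi : ∀ u v : PerSmooth L₁ L₂,
      IntegrableOn (fun x => u.1 x * v.1 x) (Ioo 0 L₁ ×ˢ Ioo 0 L₂) := fun u v =>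
    (integrable_of_continuous (perMul u v).2.1.continuous).mono_set
      (prod_mono Ioo_subset_Icc_self Ioo_subset_Icc_self)
  rw [integral_add (hi _ _) (hi _ _)] at h
  rw [inner_toL2, inner_toL2]
  linarith

theorem inner_pd₁_pow (i : ℕ) (f g : PerSmooth L₁ L₂) :
    inner ℝ (toL2 f) (toL2 ((pd₁ ^ i) g)) = (-1) ^ i * inner ℝ (toL2 ((pd₁ ^ i) f)) (toL2 g) := by
  induction i generalizing f with
  | zero => simp
  | succ i ih =>
    rw [pow_succ', Module.End.mul_apply, ← pow_succ', pow_succ pd₁ i, Module.End.mul_apply]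
    rw [pd₁, inner_pd_of_integral _ integral_pd₁, ← pd₁, ih]
    ring

theorem inner_pd₂_pow (i : ℕ) (f g : PerSmooth L₁ L₂) :
    inner ℝ (toL2 f) (toL2 ((pd₂ ^ i) g)) = (-1) ^ i * inner ℝ (toL2 ((pd₂ ^ i) f)) (toL2 g) := by
  induction i generalizing f with
  | zero => simp
  | succ i ih =>
    rw [pow_succ', Module.End.mul_apply, ← pow_succ', pow_succ pd₂ i, Module.End.mul_apply]
    rw [pd₂, inner_pd_of_integral _ integral_pd₂, ← pd₂, ih]
    ring

theorem pd_comm : Commute (pd₁ : PerSmooth L₁ L₂ →ₗ[ℝ] PerSmooth L₁ L₂) pd₂ := by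
  refine LinearMap.ext fun f => Subtype.ext (funext fun x => ?_)
  change fderiv ℝ (fun y => fderiv ℝ f.1 y (0, 1)) x (1, 0) =
    fderiv ℝ (fun y => fderiv ℝ f.1 y (1, 0)) x (0, 1)
  have hd : DifferentiableAt ℝ (fderiv ℝ f.1) x :=
    (f.2.1.fderiv_right (m := ∞) (by simp)).differentiable (by simp) x
  have hs : IsSymmSndFDerivAt ℝ f.1 x :=
    f.2.1.contDiffAt.isSymmSndFDerivAt (by
      rw [minSmoothness_of_isRCLikeNormedField]
      exact WithTop.coe_le_coe.2 (le_top : (2 : ℕ∞) ≤ ⊤))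
  rw [fderiv_clm_apply hd (differentiableAt_const _), fderiv_clm_apply hd (differentiableAt_const _)]
  simpa using hs (1, 0) (0, 1)

theorem inner_D (α : ℕ × ℕ) (f g : PerSmooth L₁ L₂) :
    inner ℝ (toL2 f) (toL2 (D α g)) = (-1) ^ (α.1 + α.2) * inner ℝ (toL2 (D α f)) (toL2 g) := by
  have h : D α f = (pd₂ ^ α.2) ((pd₁ ^ α.1) f) := by
    rw [D, (pd_comm.pow_pow α.1 α.2).eq]; rfl
  rw [h, D, Module.End.mul_apply, inner_pd₁_pow, inner_pd₂_pow]
  ring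

/-- `v` is the periodic weak derivative `∂^α u`, that is
`∫ u ∂^α φ = (-1)^|α| ∫ v φ` for all smooth periodic `φ`. -/
def IsWeakDeriv (α : ℕ × ℕ) (u v : L2 L₁ L₂) : Prop :=
  ∀ φ : PerSmooth L₁ L₂, inner ℝ u (toL2 (D α φ)) = (-1) ^ (α.1 + α.2) * inner ℝ v (toL2 φ)

/-- The multi-indices of order at most `m`. -/
def multiIdx (m : ℕ) : Finset (ℕ × ℕ) :=
  (Finset.range (m + 1) ×ˢ Finset.range (m + 1)).filter fun α => α.1 + α.2 ≤ m

/-- The multi-index zero. -/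
def zeroIdx (m : ℕ) : multiIdx m := ⟨(0, 0), by simp [multiIdx]⟩

/-- `H^m_per(Ω)`. An element is recorded as the family `(∂^α u)_{|α| ≤ m}` of a function
`u ∈ L²(Ω)` and its weak derivatives, and the norm is `(∑_{|α| ≤ m} ‖∂^α u‖²)^{1/2}`. -/
def Hper (L₁ L₂ : ℝ) (m : ℕ) : Submodule ℝ (PiLp 2 fun _ : multiIdx m => L2 L₁ L₂) where
  carrier := {u | ∀ α : multiIdx m, IsWeakDeriv α.1 (u (zeroIdx m)) (u α)}
  add_mem' := fun {u v} hu hv α φ => by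
    simp only [PiLp.add_apply, inner_add_left]
    rw [hu α φ, hv α φ]; ring
  zero_mem' := fun α φ => by simp
  smul_mem' := fun c u hu α φ => by
    simp only [PiLp.smul_apply, real_inner_smul_left]
    rw [hu α φ]; ring

/-- The inclusion `H^m_per(Ω) → L²(Ω)`. -/
def Hper.toL2 (m : ℕ) : Hper L₁ L₂ m →L[ℝ] L2 L₁ L₂ :=
  (PiLp.proj 2 (fun _ : multiIdx m => L2 L₁ L₂) (zeroIdx m)).comp (Hper L₁ L₂ m).subtypeL

/-- A smooth periodic function as an element of `H^m_per(Ω)`. -/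
def toHper (m : ℕ) : PerSmooth L₁ L₂ →ₗ[ℝ] Hper L₁ L₂ m where
  toFun f := ⟨WithLp.toLp 2 fun α => ThinFilm.toL2 (D α.1 f), fun α φ => by
    have h : D (zeroIdx m).1 f = f := by simp [D, zeroIdx]
    simp only [h]
    exact inner_D α.1 f φ⟩
  map_add' f g := by
    apply Subtype.ext; apply PiLp.ext; intro α; simp
  map_smul' c f := by
    apply Subtype.ext; apply PiLp.ext; intro α; simp

/-- `H^{-m}_per(Ω)`, the dual space of `H^m_per(Ω)`. -/
abbrev HperDual (L₁ L₂ : ℝ) (m : ℕ) : Type := StrongDual ℝ (Hper L₁ L₂ m)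

/-- The embedding `L²(Ω) → H^{-m}_per(Ω)`, `f ↦ (v ↦ ⟨f, v⟩)`. -/
def l2ToDual (m : ℕ) : L2 L₁ L₂ →L[ℝ] HperDual L₁ L₂ m :=
  LinearMap.mkContinuous
    { toFun := fun f => (innerSL ℝ f).comp (Hper.toL2 m)
      map_add' := fun f g => by ext v; simp
      map_smul' := fun c f => by ext v; simp }
    ‖Hper.toL2 (L₁ := L₁) (L₂ := L₂) m‖ fun f => by
      refine (ContinuousLinearMap.opNorm_comp_le _ _).trans ?_
      rw [innerSL_apply_norm, mul_comm]

theorem l2ToDual_apply (m : ℕ) (f : L2 L₁ L₂) (v : Hper L₁ L₂ m) :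
    l2ToDual m f v = inner ℝ f (Hper.toL2 m v) := rfl

/-- Lebesgue measure on the time interval `(0, T)`. -/
def timeMeasure (T : ℝ) : Measure ℝ := volume.restrict (Ioo 0 T)

/-- The embedding `L²(0,T;L²(Ω)) → L²(0,T;H^{-2}_per(Ω))`. -/
def embedSource (T : ℝ) :
    Lp (L2 L₁ L₂) 2 (timeMeasure T) →L[ℝ] Lp (HperDual L₁ L₂ 2) 2 (timeMeasure T) :=
  (l2ToDual 2).compLpL 2 (timeMeasure T)

/-! ### The Fourier spaces `H_N` -/

/-- The phase `ξ · x̃` with `x̃ = 2π (x₁ / L₁, x₂ / L₂)`. -/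
def phase (L₁ L₂ : ℝ) (ξ : ℤ × ℤ) (x : ℝ × ℝ) : ℝ :=
  ξ.1 * (2 * Real.pi * x.1 / L₁) + ξ.2 * (2 * Real.pi * x.2 / L₂)

theorem phase_shift (ξ : ℤ × ℤ) (x : ℝ × ℝ) :
    (∃ n : ℤ, phase L₁ L₂ ξ (x + (L₁, 0)) = phase L₁ L₂ ξ x + n * (2 * Real.pi)) ∧
    ∃ n : ℤ, phase L₁ L₂ ξ (x + (0, L₂)) = phase L₁ L₂ ξ x + n * (2 * Real.pi) := by
  constructor
  · by_cases h : L₁ = 0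
    · exact ⟨0, by simp [phase, h]⟩
    · exact ⟨ξ.1, by simp only [phase, Prod.fst_add, Prod.snd_add]; field_simp; ring⟩
  · by_cases h : L₂ = 0
    · exact ⟨0, by simp [phase, h]⟩
    · exact ⟨ξ.2, by simp only [phase, Prod.fst_add, Prod.snd_add]; field_simp; ring⟩

/-- The constant function `1`. -/
def oneMode : PerSmooth L₁ L₂ := ⟨fun _ => 1, contDiff_const, fun _ => ⟨rfl, rfl⟩⟩

/-- The function `cos (ξ · x̃)`. -/
def cosMode (ξ : ℤ × ℤ) : PerSmooth L₁ L₂ :=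
  ⟨fun x => Real.cos (phase L₁ L₂ ξ x), by unfold phase; fun_prop, fun x => by
    obtain ⟨⟨n, hn⟩, ⟨k, hk⟩⟩ := phase_shift (L₁ := L₁) (L₂ := L₂) ξ x
    exact ⟨by beta_reduce; rw [hn, Real.cos_add_int_mul_two_pi], by beta_reduce; rw [hk, Real.cos_add_int_mul_two_pi]⟩⟩

/-- The function `sin (ξ · x̃)`. -/
def sinMode (ξ : ℤ × ℤ) : PerSmooth L₁ L₂ :=
  ⟨fun x => Real.sin (phase L₁ L₂ ξ x), by unfold phase; fun_prop, fun x => by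
    obtain ⟨⟨n, hn⟩, ⟨k, hk⟩⟩ := phase_shift (L₁ := L₁) (L₂ := L₂) ξ x
    exact ⟨by beta_reduce; rw [hn, Real.sin_add_int_mul_two_pi], by beta_reduce; rw [hk, Real.sin_add_int_mul_two_pi]⟩⟩

/-- The index set `{ξ ∈ ℤ² : 0 ≤ ξ₁, ξ₂ ≤ N, ξ ≠ 0}`. -/
def quadrantFreq (N : ℕ) : Finset (ℤ × ℤ) :=
  (Finset.Icc (0 : ℤ) N ×ˢ Finset.Icc (0 : ℤ) N).erase (0, 0)

/-- The index set `{ξ ∈ ℤ² : |ξ₁|, |ξ₂| ≤ N, ξ ≠ 0}`. -/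
def squareFreq (N : ℕ) : Finset (ℤ × ℤ) :=
  (Finset.Icc (-N : ℤ) N ×ˢ Finset.Icc (-N : ℤ) N).erase (0, 0)

/-- The span of `1`, `cos (ξ · x̃)`, `sin (ξ · x̃)` for `ξ ∈ I`. -/
def trigSpace (L₁ L₂ : ℝ) (I : Finset (ℤ × ℤ)) : Submodule ℝ (PerSmooth L₁ L₂) :=
  Submodule.span ℝ ({oneMode} ∪ cosMode '' (I : Set (ℤ × ℤ)) ∪ sinMode '' (I : Set (ℤ × ℤ)))

instance (I : Finset (ℤ × ℤ)) : FiniteDimensional ℝ (trigSpace L₁ L₂ I) :=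
  FiniteDimensional.span_of_finite ℝ
    (((finite_singleton _).union (I.finite_toSet.image _)).union (I.finite_toSet.image _))

/-- The `L²(Ω)` orthogonal projection onto the span of the modes in `I`. -/
def proj (I : Finset (ℤ × ℤ)) : L2 L₁ L₂ →L[ℝ] L2 L₁ L₂ :=
  ((trigSpace L₁ L₂ I).map toL2).starProjection

/-! ### The model and its Galerkin approximation -/

/-- The two Ehrlich-Schwoebel currents. -/
inductive ESModel
  | one
  | two

/-- The function `Φ` with `J_ES(m) = Φ(|m|) m`. -/
def Phi : ESModel → (α p q : ℝ) → ℝ → ℝ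
  | .one, α, p, q, s => α * ((q - p) / ((p + s) * (q + s)))
  | .two, α, p, q, s => α * (1 / (q + (p + q) * s / p))

/-- The form
`a(h, φ) = γ ⟨∇h, ∇φ⟩ + ε² ⟨Δh, Δφ⟩ - ⟨Φ(|∇h|) ∇h, ∇φ⟩`. -/
def aForm (γ ε : ℝ) (Φ : ℝ → ℝ) (h φ : PerSmooth L₁ L₂) : ℝ :=
  γ * (∫ x, gradDot h φ x ∂boxMeasure L₁ L₂)
    + ε ^ 2 * (∫ x, (lap h).1 x * (lap φ).1 x ∂boxMeasure L₁ L₂)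
    - ∫ x, Φ (gradNorm h x) * gradDot h φ x ∂boxMeasure L₁ L₂

/-- `h : [0,T] → H_N` solves the semi-discrete Galerkin problem with initial datum `h₀` and
source `ζ`: it is absolutely continuous in time, starts at the projection of `h₀`, and satisfies
`⟨∂_t h, φ⟩ + a(h, φ) = ⟨ζ, φ⟩` for all `φ ∈ H_N` and almost all times. -/
structure IsGalerkinSolution (γ ε : ℝ) (Φ : ℝ → ℝ) (T : ℝ) (I : Finset (ℤ × ℤ))
    (h₀ : L2 L₁ L₂) (ζ : Lp (HperDual L₁ L₂ 2) 2 (timeMeasure T))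
    (h : ℝ → PerSmooth L₁ L₂) : Prop where
  mem : ∀ t ∈ Icc 0 T, h t ∈ trigSpace L₁ L₂ I
  absCont : AbsolutelyContinuousOnInterval (fun t => toL2 (h t)) 0 T
  init : toL2 (h 0) = proj I h₀
  diff : ∀ᵐ t ∂timeMeasure T, DifferentiableAt ℝ (fun t => toL2 (h t)) t
  eqn : ∀ᵐ t ∂timeMeasure T, ∀ φ ∈ trigSpace L₁ L₂ I,
    inner ℝ (deriv (fun t => toL2 (h t)) t) (toL2 φ) + aForm γ ε Φ (h t) φ = ζ t (toHper 2 φ)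

end ThinFilm

end

/-!
The decisive property of both functions `Φ` is that the current `J(m) = Φ(|m|) m` is globally
Lipschitz on the plane (`exists_fluxLipschitz_Phi`); nothing else about `Φ` is used.

On the finite-dimensional space `H_N` the form `a(h, ·)` is then a Lipschitz function of `h` in the
`L²` norm, so the Galerkin problem is an ordinary differential equation with Lipschitz vector field
and a source that is square integrable in time. Its integral form is solved on all of `[0, T]` by a
contraction in a weighted norm (`exists_integral_equation`), and uniqueness follows from Gronwall's
inequality.

The bounds independent of `N` are energy estimates. Testing with `h` gives
`½ (‖h‖²)' + γ ‖∇h‖² + ε² ‖Δh‖² = ⟨J(∇h), ∇h⟩ + ⟨ζ, h⟩`,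
and the right-hand side is absorbed by means of `‖∇h‖² ≤ ‖h‖ ‖Δh‖` and the elliptic estimate of the
`H²` norm by `‖h‖` and `‖Δh‖` (`IsGalerkinSolution.energy_estimate`). Since derivatives preserve
`H_N`, the function `Δ²h` may be used as a test function; here `⟨J(∇h), ∇Δ²h⟩` has to be bounded by
`‖Δh‖ ‖Δ²h‖`, that is, `div J(∇h)` by `‖Δh‖`, which is `abs_fluxForm_le`
(`IsGalerkinSolution.energy_estimate_lap`). The initial value `‖Δh(0)‖` is controlled by the `H²`
norm of the datum because the projection onto `H_N` can be moved onto `Δ²h(0) ∈ H_N`. Finally,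
testing with `∂ₜh` bounds the time derivative (`IsGalerkinSolution.norm_deriv_sq_le`). Gronwall's
inequality in the form `energy_gronwall` turns the differential inequalities into the bounds.

All `H²` and `H⁴` estimates rest on integration by parts in the box alone: the mixed second
derivatives satisfy `⟨∂₁²f, ∂₂²f⟩ = ‖∂₁∂₂f‖²`, so `‖Δf‖` controls the Hessian.
-/

noncomputable section

namespace ThinFilm

variable {L₁ L₂ : ℝ}

/-! ### Absolutely continuous functions, Gronwall's inequality and an integral equation -/

theorem absolutelyContinuousOnInterval_of_dist_le {X Y : Type*} [PseudoMetricSpace X]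
    [PseudoMetricSpace Y] {f : ℝ → X} {g : ℝ → Y} {a b C : ℝ}
    (hf : AbsolutelyContinuousOnInterval f a b)
    (h : ∀ s ∈ uIcc a b, ∀ t ∈ uIcc a b, dist (g s) (g t) ≤ C * dist (f s) (f t)) :
    AbsolutelyContinuousOnInterval g a b := by
  unfold AbsolutelyContinuousOnInterval at hf ⊢
  refine squeeze_zero' (.of_forall fun _ => Finset.sum_nonneg fun _ _ => dist_nonneg) ?_
    (by simpa using hf.const_mul C)
  rw [Filter.eventually_inf_principal]
  filter_upwards with E hE
  rw [Finset.mul_sum]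
  exact Finset.sum_le_sum fun i hi => h _ (hE.1 i hi).1 _ (hE.1 i hi).2

theorem absolutelyContinuousOnInterval_norm_sq {E : Type*} [NormedAddCommGroup E]
    {f : ℝ → E} {a b : ℝ} (hf : AbsolutelyContinuousOnInterval f a b) :
    AbsolutelyContinuousOnInterval (fun t => ‖f t‖ ^ 2) a b := by
  have h : AbsolutelyContinuousOnInterval (fun t => ‖f t‖) a b := by
    refine absolutelyContinuousOnInterval_of_dist_le (C := 1) hf fun s _ t _ => ?_
    rw [dist_eq_norm, dist_eq_norm, one_mul]
    exact abs_norm_sub_norm_le _ _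
  simpa [pow_two] using h.fun_mul h

/-- The energy form of Gronwall's inequality: the dissipation `d` is controlled together with `u`.
The differential inequality is only needed almost everywhere, since `e^{-Kt} u(t)` is absolutely
continuous and hence the integral of its derivative. -/
theorem energy_gronwall {u d b : ℝ → ℝ} {T K : ℝ} (hT : 0 ≤ T) (hK : 0 ≤ K)
    (hu : AbsolutelyContinuousOnInterval u 0 T) (hu0 : ∀ t ∈ Icc 0 T, 0 ≤ u t)
    (hd : IntegrableOn d (Ioo 0 T)) (hd0 : ∀ t, 0 ≤ d t)
    (hb : IntegrableOn b (Ioo 0 T)) (hb0 : ∀ t, 0 ≤ b t)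
    (h : ∀ᵐ t ∂volume.restrict (Ioo 0 T), deriv u t + d t ≤ K * u t + b t) :
    ∀ t ∈ Icc 0 T, u t + ∫ s in Ioo 0 t, d s ≤ Real.exp (K * T) * (u 0 + ∫ s in Ioo 0 T, b s) := by
  intro t ht
  have hsub : uIcc 0 t ⊆ uIcc 0 T := by
    rw [uIcc_of_le ht.1, uIcc_of_le hT]; exact Icc_subset_Icc_right ht.2
  have hsub' : Ioo 0 t ⊆ Ioo 0 T := Ioo_subset_Ioo_right ht.2
  have hut := hu.mono hsub
  have he : AbsolutelyContinuousOnInterval (fun s => Real.exp (-K * s)) 0 t :=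
    ContDiffOn.absolutelyContinuousOnInterval (by fun_prop)
  have hv := he.fun_mul hut
  have hftc := hv.integral_deriv_eq_sub
  have hint := hv.intervalIntegrable_deriv
  rw [intervalIntegrable_iff_integrableOn_Ioo_of_le ht.1] at hint
  rw [intervalIntegral.integral_of_le ht.1, integral_Ioc_eq_integral_Ioo] at hftc
  have hdt := hd.mono_set hsub'
  have hbt := hb.mono_set hsub'
  have hle : ∫ s in Ioo 0 t, deriv (fun s => Real.exp (-K * s) * u s) s ≤
      ∫ s in Ioo 0 t, (b s - Real.exp (-(K * T)) * d s) := by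
    refine integral_mono_ae hint (hbt.sub (hdt.const_mul _)) ?_
    have h1 := ae_restrict_of_ae_restrict_of_subset hsub' h
    have h2 : ∀ᵐ s ∂volume.restrict (Ioo 0 t), DifferentiableAt ℝ u s := by
      rw [ae_restrict_iff' measurableSet_Ioo]
      filter_upwards [hut.ae_differentiableAt] with s hs hs'
      exact hs (by rw [uIcc_of_le ht.1]; exact Ioo_subset_Icc_self hs')
    filter_upwards [h1, h2, ae_restrict_mem measurableSet_Ioo] with s h1 h2 hs
    have h3 : HasDerivAt (fun s => Real.exp (-K * s)) (Real.exp (-K * s) * -K) s := by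
      simpa using ((hasDerivAt_id s).const_mul (-K)).exp
    rw [(h3.fun_mul h2.hasDerivAt).deriv]
    have h4 : Real.exp (-K * s) ≤ 1 := Real.exp_le_one_iff.2 (by nlinarith [hs.1])
    have h5 : Real.exp (-(K * T)) ≤ Real.exp (-K * s) :=
      Real.exp_le_exp.2 (by nlinarith [hs.2, ht.2])
    have h6 := mul_le_mul_of_nonneg_left h1 (Real.exp_pos (-K * s)).le
    nlinarith [mul_le_mul_of_nonneg_right h4 (hb0 s), mul_le_mul_of_nonneg_right h5 (hd0 s)]
  rw [hftc, integral_sub hbt (hdt.const_mul _), integral_const_mul] at hle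
  have hbb : ∫ s in Ioo 0 t, b s ≤ ∫ s in Ioo 0 T, b s :=
    setIntegral_mono_set hb (.of_forall hb0) hsub'.eventuallyLE
  have h5 : Real.exp (-(K * T)) ≤ Real.exp (-K * t) :=
      Real.exp_le_exp.2 (by nlinarith [ht.2])
  -- All weights `e^{-Ks}` with `s ≤ T` are bounded below by `e^{-KT}`.
  have h7 : Real.exp (-(K * T)) * (u t + ∫ s in Ioo 0 t, d s) ≤ u 0 + ∫ s in Ioo 0 T, b s := by
    simp only [mul_zero, Real.exp_zero, one_mul] at hle
    nlinarith [mul_le_mul_of_nonneg_right h5 (hu0 t ht)]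
  calc _ = Real.exp (K * T) * (Real.exp (-(K * T)) * (u t + ∫ s in Ioo 0 t, d s)) := by
        rw [← mul_assoc, ← Real.exp_add]; simp
    _ ≤ _ := by gcongr

/-- The integral equation `y(t) = F(t) + ∫₀ᵗ G(y(s)) ds` with a globally Lipschitz `G` is solvable
on the whole interval: the Picard map is a contraction for the norm weighted by `e^{-(K+1)t}`. -/
theorem exists_integral_equation {E : Type*} [NormedAddCommGroup E] [NormedSpace ℝ E]
    [CompleteSpace E] {G : E → E} {K : NNReal} (hG : LipschitzWith K G) {F : ℝ → E} {T : ℝ}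
    (hT : 0 ≤ T) (hF : ContinuousOn F (Icc 0 T)) :
    ∃ y : ℝ → E, ContinuousOn y (Icc 0 T) ∧
      ∀ t ∈ Icc 0 T, y t = F t + ∫ s in (0)..t, G (y s) := by
  set l : ℝ := K + 1 with hl
  have hl0 : 0 < l := by positivity
  -- A weighted path, extended by constants, as a continuous integrand on the line.
  let g : C(Icc 0 T, E) → ℝ → E := fun v s => G (Real.exp (l * s) • v (projIcc 0 T hT s))
  have hg : ∀ v, Continuous (g v) := fun v =>
    hG.continuous.comp ((by fun_prop : Continuous fun s : ℝ => Real.exp (l * s)).smul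
      (v.continuous.comp continuous_projIcc))
  let Y : C(Icc 0 T, E) → ℝ → E := fun v t => F t + ∫ s in (0)..t, g v s
  have hY : ∀ v, ContinuousOn (Y v) (Icc 0 T) := fun v =>
    hF.add (intervalIntegral.continuous_primitive
      (fun a b => (hg v).intervalIntegrable a b) 0).continuousOn
  let S : C(Icc 0 T, E) → C(Icc 0 T, E) := fun v =>
    ⟨fun t => Real.exp (-(l * t)) • Y v t, by
      have := (hY v).domRestrict
      exact (by fun_prop : Continuous fun t : Icc (0 : ℝ) T => Real.exp (-(l * t))).smul this⟩
  have hS : ContractingWith (K / (K + 1)) S := by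
    refine ⟨(div_lt_one (by positivity)).2 (by simp), ?_⟩
    refine LipschitzWith.of_dist_le_mul fun v w => ?_
    rw [ContinuousMap.dist_le (by positivity)]
    intro t
    obtain ⟨t, ht⟩ := t
    have h1 : ∀ s, ‖g v s - g w s‖ ≤ K * dist v w * Real.exp (l * s) := fun s => by
      rw [← dist_eq_norm]
      refine (hG.dist_le_mul _ _).trans ?_
      rw [dist_smul₀, Real.norm_of_nonneg (Real.exp_pos _).le]
      have := ContinuousMap.dist_apply_le_dist (f := v) (g := w) (projIcc 0 T hT s)
      calc _ ≤ K * (Real.exp (l * s) * dist v w) := by gcongr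
        _ = _ := by ring
    have h2 : ‖∫ s in (0)..t, (g v s - g w s)‖ ≤
        ∫ s in (0)..t, K * dist v w * Real.exp (l * s) :=
      intervalIntegral.norm_integral_le_of_norm_le ht.1 (.of_forall fun s _ => h1 s)
        (Continuous.intervalIntegrable (by fun_prop) _ _)
    have h3 : ∫ s in (0)..t, K * dist v w * Real.exp (l * s) =
        K * dist v w * ((Real.exp (l * t) - 1) / l) := by
      rw [intervalIntegral.integral_const_mul, intervalIntegral.integral_comp_mul_left _ hl0.ne']
      rw [integral_exp, mul_zero, Real.exp_zero, smul_eq_mul, inv_mul_eq_div]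
    have h4 : Y v t - Y w t = ∫ s in (0)..t, (g v s - g w s) := by
      rw [intervalIntegral.integral_sub ((hg v).intervalIntegrable _ _)
        ((hg w).intervalIntegrable _ _)]
      simp [Y]
    change dist (Real.exp (-(l * t)) • Y v t) (Real.exp (-(l * t)) • Y w t) ≤ _
    rw [dist_smul₀, dist_eq_norm, h4, Real.norm_of_nonneg (Real.exp_pos _).le]
    have h5 : Real.exp (-(l * t)) * Real.exp (l * t) = 1 := by rw [← Real.exp_add]; simp
    calc _ ≤ Real.exp (-(l * t)) * (K * dist v w * ((Real.exp (l * t) - 1) / l)) := by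
          rw [← h3]; gcongr
      _ = K / l * dist v w * (Real.exp (-(l * t)) * Real.exp (l * t) - Real.exp (-(l * t))) := by
          ring
      _ = K / l * dist v w * (1 - Real.exp (-(l * t))) := by rw [h5]
      _ ≤ K / l * dist v w * 1 := by
          gcongr; linarith [Real.exp_pos (-(l * t))]
      _ = _ := by simp [hl]
  have hne : Nonempty C(Icc 0 T, E) := ⟨0⟩
  have hfix := hS.fixedPoint_isFixedPt
  set v := ContractingWith.fixedPoint S hS
  refine ⟨Y v, hY v, fun t ht => ?_⟩
  change F t + _ = F t + _
  congr 1
  refine intervalIntegral.integral_congr fun s hs => ?_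
  rw [uIcc_of_le ht.1] at hs
  have hs' : s ∈ Icc 0 T := ⟨hs.1, hs.2.trans ht.2⟩
  have h1 : Real.exp (-(l * s)) • Y v s = v ⟨s, hs'⟩ := congrArg (fun w => w ⟨s, hs'⟩) hfix
  change G (Real.exp (l * s) • v (projIcc 0 T hT s)) = G (Y v s)
  rw [projIcc_of_mem hT hs', ← h1, smul_smul, ← Real.exp_add]
  simp

/-! ### Integration by parts and elliptic estimates -/

theorem inner_pd₁ (f g : PerSmooth L₁ L₂) :
    inner ℝ (toL2 f) (toL2 (pd₁ g)) = -inner ℝ (toL2 (pd₁ f)) (toL2 g) :=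
  inner_pd_of_integral _ integral_pd₁ f g

theorem inner_pd₂ (f g : PerSmooth L₁ L₂) :
    inner ℝ (toL2 f) (toL2 (pd₂ g)) = -inner ℝ (toL2 (pd₂ f)) (toL2 g) :=
  inner_pd_of_integral _ integral_pd₂ f g

theorem pd₁_pd₂ (f : PerSmooth L₁ L₂) : pd₁ (pd₂ f) = pd₂ (pd₁ f) :=
  LinearMap.congr_fun pd_comm.eq f

theorem lap_apply (f : PerSmooth L₁ L₂) : lap f = pd₁ (pd₁ f) + pd₂ (pd₂ f) := by
  simp [lap, D, pow_two]

theorem D_add (a b : ℕ × ℕ) (f : PerSmooth L₁ L₂) : D (a + b) f = D a (D b f) := by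
  have h : (D (a + b) : PerSmooth L₁ L₂ →ₗ[ℝ] PerSmooth L₁ L₂) = D a * D b := by
    simp only [D, Prod.fst_add, Prod.snd_add, pow_add]
    exact (pd_comm.pow_pow b.1 a.2).mul_mul_mul_comm _ _
  rw [h]; rfl

theorem lap_D (a : ℕ × ℕ) (f : PerSmooth L₁ L₂) : lap (D a f) = D a (lap f) := by
  simp only [lap, LinearMap.add_apply, map_add, ← D_add, add_comm]

theorem inner_lap_left (f g : PerSmooth L₁ L₂) :
    inner ℝ (toL2 (lap f)) (toL2 g) =
      -(inner ℝ (toL2 (pd₁ f)) (toL2 (pd₁ g)) + inner ℝ (toL2 (pd₂ f)) (toL2 (pd₂ g))) := by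
  rw [lap_apply, map_add, inner_add_left, inner_pd₁, inner_pd₂]
  ring

theorem inner_lap_comm (f g : PerSmooth L₁ L₂) :
    inner ℝ (toL2 (lap f)) (toL2 g) = inner ℝ (toL2 f) (toL2 (lap g)) := by
  rw [inner_lap_left, real_inner_comm _ (toL2 f), inner_lap_left]
  simp only [real_inner_comm]

/-- Integration by parts: `‖∇f‖² = -⟨f, Δf⟩`. -/
theorem norm_grad_sq (f : PerSmooth L₁ L₂) :
    ‖toL2 (pd₁ f)‖ ^ 2 + ‖toL2 (pd₂ f)‖ ^ 2 = -inner ℝ (toL2 f) (toL2 (lap f)) := by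
  rw [← inner_lap_comm, inner_lap_left, real_inner_self_eq_norm_sq, real_inner_self_eq_norm_sq]
  ring

theorem norm_grad_sq_le (f : PerSmooth L₁ L₂) :
    ‖toL2 (pd₁ f)‖ ^ 2 + ‖toL2 (pd₂ f)‖ ^ 2 ≤ ‖toL2 f‖ * ‖toL2 (lap f)‖ := by
  rw [norm_grad_sq]
  exact (neg_le_abs _).trans (abs_real_inner_le_norm _ _)

/-- The Hessian is controlled by the Laplacian: two integrations by parts give
`⟨∂₁²f, ∂₂²f⟩ = ‖∂₁∂₂f‖²`, so that `‖Δf‖` is the `L²` norm of the whole Hessian. -/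
theorem norm_lap_sq (f : PerSmooth L₁ L₂) :
    ‖toL2 (lap f)‖ ^ 2 = ‖toL2 (pd₁ (pd₁ f))‖ ^ 2 + ‖toL2 (pd₂ (pd₂ f))‖ ^ 2
      + 2 * ‖toL2 (pd₁ (pd₂ f))‖ ^ 2 := by
  have h : inner ℝ (toL2 (pd₁ (pd₁ f))) (toL2 (pd₂ (pd₂ f))) = ‖toL2 (pd₁ (pd₂ f))‖ ^ 2 := by
    rw [inner_pd₂, ← pd₁_pd₂, ← pd₁_pd₂, real_inner_comm, inner_pd₁, neg_neg,
      real_inner_self_eq_norm_sq]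
  rw [lap_apply, map_add, norm_add_sq_real, h]
  ring

theorem norm_lap_sq_le (f : PerSmooth L₁ L₂) :
    ‖toL2 (lap f)‖ ^ 2 ≤ ‖toL2 f‖ * ‖toL2 (lap (lap f))‖ := by
  rw [← real_inner_self_eq_norm_sq, inner_lap_comm]
  exact real_inner_le_norm _ _

theorem norm_D_le_of_order_two {a : ℕ × ℕ} (ha : a.1 + a.2 ≤ 2) (f : PerSmooth L₁ L₂) :
    ‖toL2 (D a f)‖ ^ 2 ≤ ‖toL2 f‖ ^ 2 + ‖toL2 (lap f)‖ ^ 2 := by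
  have h1 := norm_grad_sq_le f
  have h2 := norm_lap_sq f
  obtain ⟨i, j⟩ := a
  simp only at ha
  have hi : i ≤ 2 := by omega
  have hj : j ≤ 2 := by omega
  interval_cases i <;> interval_cases j <;> first | omega | skip
  all_goals simp only [D, pow_zero, pow_one, pow_two, Module.End.mul_apply, Module.End.one_apply]
  all_goals
    nlinarith [sq_nonneg (‖toL2 f‖ - ‖toL2 (lap f)‖), sq_nonneg ‖toL2 f‖, sq_nonneg ‖toL2 (lap f)‖,
      sq_nonneg ‖toL2 (pd₁ f)‖, sq_nonneg ‖toL2 (pd₂ f)‖, sq_nonneg ‖toL2 (pd₁ (pd₁ f))‖,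
      sq_nonneg ‖toL2 (pd₁ (pd₂ f))‖, sq_nonneg ‖toL2 (pd₂ (pd₂ f))‖]

/-- The multi-index is split into two of order at most two, to each of which
`norm_D_le_of_order_two` applies because `Δ` commutes with derivatives. -/
theorem norm_D_le_of_order_four {a : ℕ × ℕ} (ha : a.1 + a.2 ≤ 4) (f : PerSmooth L₁ L₂) :
    ‖toL2 (D a f)‖ ^ 2 ≤ 3 * (‖toL2 f‖ ^ 2 + ‖toL2 (lap (lap f))‖ ^ 2) := by
  obtain ⟨b, c, rfl, hb, hc⟩ : ∃ b c : ℕ × ℕ, a = b + c ∧ b.1 + b.2 ≤ 2 ∧ c.1 + c.2 ≤ 2 := by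
    obtain ⟨i, j⟩ := a
    refine ⟨(min i 2, min j (2 - min i 2)), (i - min i 2, j - min j (2 - min i 2)), ?_, ?_, ?_⟩
    · simp only [Prod.mk_add_mk, Prod.mk.injEq]; omega
    · simp only; omega
    · simp only at ha ⊢; omega
  rw [D_add]
  have h1 := norm_D_le_of_order_two hb (D c f)
  rw [lap_D] at h1
  have h2 := norm_D_le_of_order_two hc f
  have h3 := norm_D_le_of_order_two hc (lap f)
  have h4 := norm_lap_sq_le f
  nlinarith [sq_nonneg (‖toL2 f‖ - ‖toL2 (lap (lap f))‖)]

theorem norm_toHper_sq (m : ℕ) (f : PerSmooth L₁ L₂) :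
    ‖toHper m f‖ ^ 2 = ∑ a : multiIdx m, ‖toL2 (D a.1 f)‖ ^ 2 :=
  PiLp.norm_sq_eq_of_L2 _ (toHper m f).1

theorem mem_multiIdx {m : ℕ} (a : multiIdx m) : a.1.1 + a.1.2 ≤ m :=
  (Finset.mem_filter.1 a.2).2

theorem norm_toHper_two_sq_le (f : PerSmooth L₁ L₂) :
    ‖toHper 2 f‖ ^ 2 ≤ 6 * (‖toL2 f‖ ^ 2 + ‖toL2 (lap f)‖ ^ 2) := by
  rw [norm_toHper_sq]
  refine (Finset.sum_le_card_nsmul _ _ _ fun a _ =>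
    norm_D_le_of_order_two (mem_multiIdx a) f).trans_eq ?_
  have : Fintype.card (multiIdx 2) = 6 := by decide
  rw [Finset.card_univ, this]; simp [mul_add]

theorem norm_toHper_four_sq_le (f : PerSmooth L₁ L₂) :
    ‖toHper 4 f‖ ^ 2 ≤ 45 * (‖toL2 f‖ ^ 2 + ‖toL2 (lap (lap f))‖ ^ 2) := by
  rw [norm_toHper_sq]
  refine (Finset.sum_le_card_nsmul _ _ _ fun a _ =>
    norm_D_le_of_order_four (mem_multiIdx a) f).trans_eq ?_
  have : Fintype.card (multiIdx 4) = 15 := by decide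
  rw [Finset.card_univ, this]
  simp only [nsmul_eq_mul]; push_cast; ring

theorem norm_Hper_apply_le {m : ℕ} (u : Hper L₁ L₂ m) (a : multiIdx m) : ‖u.1 a‖ ≤ ‖u‖ :=
  PiLp.norm_apply_le u.1 a

/-! ### Periodic functions: bounds, shifts, difference quotients -/

/-- Every value of a periodic function is attained on the closed box. -/
theorem periodic_exists_mem_box (hL₁ : 0 < L₁) (hL₂ : 0 < L₂) {f : ℝ × ℝ → ℝ}
    (hf : ∀ x, f (x + (L₁, 0)) = f x ∧ f (x + (0, L₂)) = f x) (x : ℝ × ℝ) :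
    ∃ y ∈ Icc 0 L₁ ×ˢ Icc 0 L₂, f y = f x := by
  have h1 : Function.Periodic f (L₁, 0) := fun x => (hf x).1
  have h2 : Function.Periodic f (0, L₂) := fun x => (hf x).2
  obtain ⟨a, b⟩ := x
  refine ⟨(toIcoMod hL₁ 0 a, toIcoMod hL₂ 0 b), ⟨?_, ?_⟩, ?_⟩
  · exact Ico_subset_Icc_self (by simpa using toIcoMod_mem_Ico hL₁ 0 a)
  · exact Ico_subset_Icc_self (by simpa using toIcoMod_mem_Ico hL₂ 0 b)
  · rw [← h1.zsmul (toIcoDiv hL₁ 0 a), ← h2.zsmul (toIcoDiv hL₂ 0 b)]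
    congr 1
    simp only [Prod.smul_mk, Prod.mk_add_mk, smul_zero, add_zero, toIcoMod_add_toIcoDiv_zsmul]

theorem perSmooth_bounded (hL₁ : 0 < L₁) (hL₂ : 0 < L₂) (f : PerSmooth L₁ L₂) :
    ∃ C, ∀ x, |f.1 x| ≤ C := by
  obtain ⟨C, hC⟩ := (isCompact_Icc.prod isCompact_Icc : IsCompact
    (Icc (0 : ℝ) L₁ ×ˢ Icc (0 : ℝ) L₂)).exists_bound_of_continuousOn f.2.1.continuous.continuousOn
  refine ⟨C, fun x => ?_⟩
  obtain ⟨y, hy, h⟩ := periodic_exists_mem_box hL₁ hL₂ f.2.2 x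
  rw [← h]; exact hC y hy

theorem integrable_box {F : ℝ × ℝ → ℝ} (hF : Continuous F) : Integrable F (boxMeasure L₁ L₂) :=
  (integrable_of_continuous hF).mono_set (prod_mono Ioo_subset_Icc_self Ioo_subset_Icc_self)

theorem integral_box_shift (hL₁ : 0 < L₁) (hL₂ : 0 < L₂) {F : ℝ × ℝ → ℝ} (hF : Continuous F)
    (hp : ∀ x, F (x + (L₁, 0)) = F x ∧ F (x + (0, L₂)) = F x) (c : ℝ × ℝ) :
    ∫ x, F (x + c) ∂boxMeasure L₁ L₂ = ∫ x, F x ∂boxMeasure L₁ L₂ := by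
  rw [boxMeasure, integral_box_eq hF hL₁.le hL₂.le,
    integral_box_eq (F := fun x => F (x + c)) (by fun_prop) hL₁.le hL₂.le]
  have h2 : ∀ x, ∫ y in (0)..L₂, F (x + c.1, y + c.2) = ∫ y in (0)..L₂, F (x + c.1, y) := by
    intro x
    have hper : Function.Periodic (fun y => F (x + c.1, y)) L₂ := fun y => by
      simpa using (hp (x + c.1, y)).2
    have := hper.intervalIntegral_add_eq c.2 0
    rw [intervalIntegral.integral_comp_add_right (fun y => F (x + c.1, y))]
    simpa [add_comm] using this
  have hper : Function.Periodic (fun x => ∫ y in (0)..L₂, F (x, y)) L₁ := fun x => by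
    refine intervalIntegral.integral_congr fun y _ => ?_
    simpa using (hp (x, y)).1
  have := hper.intervalIntegral_add_eq c.1 0
  calc _ = ∫ x in (0)..L₁, ∫ y in (0)..L₂, F (x + c.1, y) :=
        intervalIntegral.integral_congr fun x _ => h2 x
    _ = _ := by
        rw [intervalIntegral.integral_comp_add_right (fun x => ∫ y in (0)..L₂, F (x, y))]
        simpa [add_comm] using this

theorem hasDerivAt_line (f : PerSmooth L₁ L₂) (e x : ℝ × ℝ) (t : ℝ) :
    HasDerivAt (fun t : ℝ => f.1 (x + t • e)) ((pd e f).1 (x + t • e)) t := by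
  have h : HasDerivAt (fun t : ℝ => x + t • e) e t := by
    simpa using ((hasDerivAt_id t).smul_const e).const_add x
  exact (perDiff f (x + t • e)).hasFDerivAt.comp_hasDerivAt t h

/-- The difference quotient of `f` in direction `e`. -/
def diffQuot (f : ℝ × ℝ → ℝ) (e : ℝ × ℝ) (t : ℝ) (x : ℝ × ℝ) : ℝ := t⁻¹ * (f (x + t • e) - f x)

theorem tendsto_diffQuot (f : PerSmooth L₁ L₂) (e x : ℝ × ℝ) :
    Filter.Tendsto (fun t => diffQuot f.1 e t x) (nhdsWithin 0 {0}ᶜ) (nhds ((pd e f).1 x)) := by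
  have h := hasDerivAt_iff_tendsto_slope_zero.1 (hasDerivAt_line f e x 0)
  simpa [diffQuot] using h

theorem diffQuot_bounded (hL₁ : 0 < L₁) (hL₂ : 0 < L₂) (f : PerSmooth L₁ L₂) (e : ℝ × ℝ) :
    ∃ C, ∀ t x, |diffQuot f.1 e t x| ≤ C := by
  obtain ⟨C, hC⟩ := perSmooth_bounded hL₁ hL₂ (pd e f)
  refine ⟨C, fun t x => ?_⟩
  have hC0 : 0 ≤ C := (abs_nonneg _).trans (hC 0)
  by_cases ht : t = 0
  · simpa [diffQuot, ht] using hC0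
  have h := Convex.norm_image_sub_le_of_norm_hasDerivWithin_le (f := fun t : ℝ => f.1 (x + t • e))
    (C := C) (s := univ) (x := 0) (y := t)
    (fun s _ => (hasDerivAt_line f e x s).hasDerivWithinAt) (fun s _ => hC _) convex_univ
    (mem_univ _) (mem_univ _)
  simp only [zero_smul, add_zero, sub_zero, Real.norm_eq_abs] at h
  rw [diffQuot, abs_mul, abs_inv, inv_mul_le_iff₀ (abs_pos.2 ht), mul_comm]
  exact h

theorem continuous_diffQuot {f : ℝ × ℝ → ℝ} (hf : Continuous f) (e : ℝ × ℝ) (t : ℝ) :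
    Continuous (diffQuot f e t) := by
  unfold diffQuot; fun_prop

/-- Discrete integration by parts. -/
theorem integral_mul_diffQuot (hL₁ : 0 < L₁) (hL₂ : 0 < L₂) {F : ℝ × ℝ → ℝ} (hF : Continuous F)
    (hp : ∀ x, F (x + (L₁, 0)) = F x ∧ F (x + (0, L₂)) = F x) (f : PerSmooth L₁ L₂) (e : ℝ × ℝ)
    (t : ℝ) :
    ∫ x, F x * diffQuot f.1 e t x ∂boxMeasure L₁ L₂ =
      ∫ x, diffQuot F (-e) t x * f.1 x ∂boxMeasure L₁ L₂ := by
  have hf : Continuous f.1 := f.2.1.continuous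
  have h := integral_box_shift hL₁ hL₂ (F := fun x => F (x + t • -e) * f.1 x) (by fun_prop)
    (fun x => by
      constructor
      · rw [add_right_comm, (hp _).1, (f.2.2 x).1]
      · rw [add_right_comm, (hp _).2, (f.2.2 x).2]) (t • e)
  simp only [smul_neg, add_neg_cancel_right] at h
  simp only [diffQuot, mul_left_comm _ t⁻¹, mul_assoc, mul_sub, sub_mul,
    smul_neg]
  rw [integral_sub (integrable_box (by fun_prop)) (integrable_box (by fun_prop)),
    integral_sub (integrable_box (by fun_prop)) (integrable_box (by fun_prop))]
  simp only [integral_const_mul]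
  rw [h]

theorem integral_abs_mul_abs_le (f g : PerSmooth L₁ L₂) :
    ∫ x, |f.1 x| * |g.1 x| ∂boxMeasure L₁ L₂ ≤ ‖toL2 f‖ * ‖toL2 g‖ := by
  have h := real_inner_le_norm |toL2 f| |toL2 g|
  rw [norm_abs_eq_norm, norm_abs_eq_norm, L2.inner_def] at h
  refine le_trans (le_of_eq (integral_congr_ae ?_)) h
  filter_upwards [Lp.coeFn_abs (toL2 f), Lp.coeFn_abs (toL2 g), (perMemLp f).coeFn_toLp,
    (perMemLp g).coeFn_toLp] with x h1 h2 h3 h4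
  have h3' : (toL2 f : ℝ × ℝ → ℝ) x = f.1 x := h3
  have h4' : (toL2 g : ℝ × ℝ → ℝ) x = g.1 x := h4
  rw [h1, h2, h3', h4']
  simp [mul_comm]

/-! ### The current -/

/-- The first component of the current `J(m) = Φ(|m|) m` at `m = (a, b)`. The second component is
`flux Φ b a`. -/
def flux (Φ : ℝ → ℝ) (a b : ℝ) : ℝ := Φ (Real.sqrt (a ^ 2 + b ^ 2)) * a

/-- The current `m ↦ Φ(|m|) m` is Lipschitz with constant `M`, for the `ℓ¹` norm of the argument.
By symmetry in the two components it suffices to say this of the first one. -/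
def FluxLipschitz (Φ : ℝ → ℝ) (M : ℝ) : Prop :=
  ∀ a b c d, |flux Φ a b - flux Φ c d| ≤ M * (|a - c| + |b - d|)

theorem abs_sqrt_sub_sqrt_le (a b c d : ℝ) :
    |Real.sqrt (a ^ 2 + b ^ 2) - Real.sqrt (c ^ 2 + d ^ 2)| ≤ |a - c| + |b - d| := by
  have h1 := abs_norm_sub_norm_le (⟨a, b⟩ : ℂ) ⟨c, d⟩
  have h2 := Complex.norm_le_abs_re_add_abs_im ((⟨a, b⟩ : ℂ) - ⟨c, d⟩)
  simp only [Complex.norm_def, Complex.normSq_mk, ← pow_two] at h1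
  rw [← Complex.norm_def] at h1
  exact h1.trans h2

/-- With `s = |m|`, the difference of two values is
`(a - c) / (r + s) + c / (r + s') * (s' - s) / (r + s)`, where `|c| ≤ s'` and `s` is `1`-Lipschitz
in `m`. -/
theorem fluxLipschitz_inv {r : ℝ} (hr : 0 < r) : FluxLipschitz (fun s => 1 / (r + s)) (2 / r) := by
  intro a b c d
  unfold flux
  have h := abs_sqrt_sub_sqrt_le a b c d
  have hc : |c| ≤ Real.sqrt (c ^ 2 + d ^ 2) := Real.abs_le_sqrt (by nlinarith [sq_nonneg d])
  have hs := Real.sqrt_nonneg (a ^ 2 + b ^ 2)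
  have hs' := Real.sqrt_nonneg (c ^ 2 + d ^ 2)
  set s := Real.sqrt (a ^ 2 + b ^ 2)
  set s' := Real.sqrt (c ^ 2 + d ^ 2)
  have e : 1 / (r + s) * a - 1 / (r + s') * c =
      (a - c) / (r + s) + c / (r + s') * ((s' - s) / (r + s)) := by
    field_simp; ring
  have h1 : |(a - c) / (r + s)| ≤ |a - c| / r := by
    rw [abs_div, abs_of_pos (by positivity : 0 < r + s)]
    gcongr; linarith
  have h2 : |(s' - s) / (r + s)| ≤ |s - s'| / r := by
    rw [abs_div, abs_of_pos (by positivity : 0 < r + s), abs_sub_comm]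
    gcongr; linarith
  have h3 : |c / (r + s')| ≤ 1 := by
    rw [abs_div, abs_of_pos (by positivity : 0 < r + s'), div_le_one (by positivity)]
    linarith
  calc |1 / (r + s) * a - 1 / (r + s') * c|
      ≤ |(a - c) / (r + s)| + |c / (r + s')| * |(s' - s) / (r + s)| := by
        rw [e, ← abs_mul]; exact abs_add_le _ _
    _ ≤ |a - c| / r + 1 * ((|a - c| + |b - d|) / r) := by
        gcongr
        exact h2.trans (by gcongr)
    _ ≤ (|a - c| + |b - d|) / r + 1 * ((|a - c| + |b - d|) / r) := by
        gcongr; linarith [abs_nonneg (b - d)]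
    _ = 2 / r * (|a - c| + |b - d|) := by ring

theorem FluxLipschitz.comb {Φ Ψ : ℝ → ℝ} {M N : ℝ} (h : FluxLipschitz Φ M)
    (h' : FluxLipschitz Ψ N) (A B : ℝ) :
    FluxLipschitz (fun s => A * Φ s + B * Ψ s) (|A| * M + |B| * N) := by
  intro a b c d
  have e : flux (fun s => A * Φ s + B * Ψ s) a b - flux (fun s => A * Φ s + B * Ψ s) c d =
      A * (flux Φ a b - flux Φ c d) + B * (flux Ψ a b - flux Ψ c d) := by
    unfold flux; ring
  rw [e]
  refine (abs_add_le _ _).trans ?_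
  rw [abs_mul, abs_mul, add_mul, mul_assoc, mul_assoc]
  exact add_le_add (mul_le_mul_of_nonneg_left (h _ _ _ _) (abs_nonneg _))
    (mul_le_mul_of_nonneg_left (h' _ _ _ _) (abs_nonneg _))

theorem FluxLipschitz.congr {Φ Ψ : ℝ → ℝ} {M : ℝ} (h : FluxLipschitz Φ M)
    (e : ∀ s, 0 ≤ s → Ψ s = Φ s) : FluxLipschitz Ψ M := by
  intro a b c d
  unfold flux
  rw [e _ (Real.sqrt_nonneg _), e _ (Real.sqrt_nonneg _)]
  exact h a b c d

/-- Both `Φ₁` and `Φ₂` are combinations of functions `s ↦ 1 / (r + s)`: partial fractions give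
`Φ₁(s) = α (1 / (p + s) - 1 / (q + s))`, and `Φ₂(s) = (α p / (p + q)) / (p q / (p + q) + s)`. -/
theorem exists_fluxLipschitz_Phi {α p q : ℝ} (hp : 0 < p) (hpq : p < q) (k : ESModel) :
    ∃ M, 0 ≤ M ∧ FluxLipschitz (Phi k α p q) M := by
  have hq : 0 < q := hp.trans hpq
  cases k with
  | one =>
    refine ⟨_, ?_, ((fluxLipschitz_inv hp).comb (fluxLipschitz_inv hq) α (-α)).congr fun s hs => ?_⟩
    · positivity
    · have : 0 < p + s := by positivity
      have : 0 < q + s := by positivity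
      simp only [Phi]; field_simp; ring
  | two =>
    have hr : 0 < q * p / (p + q) := by positivity
    refine ⟨_, ?_, ((fluxLipschitz_inv hr).comb (fluxLipschitz_inv hr)
      (α * p / (p + q)) 0).congr fun s hs => ?_⟩
    · positivity
    · simp only [Phi]; field_simp; ring

theorem FluxLipschitz.continuous {Φ : ℝ → ℝ} {M : ℝ} (h : FluxLipschitz Φ M) :
    Continuous fun z : ℝ × ℝ => flux Φ z.1 z.2 := by
  rw [continuous_iff_continuousAt]
  intro z
  rw [ContinuousAt, tendsto_iff_dist_tendsto_zero]
  have h2 : Continuous fun w : ℝ × ℝ => M * (|w.1 - z.1| + |w.2 - z.2|) := by fun_prop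
  have h3 := h2.tendsto z
  simp only [sub_self, abs_zero, add_zero, mul_zero] at h3
  exact squeeze_zero (fun _ => dist_nonneg) (fun w => h _ _ _ _) h3

theorem FluxLipschitz.continuous_comp {Φ : ℝ → ℝ} {M : ℝ} (h : FluxLipschitz Φ M)
    (u v : PerSmooth L₁ L₂) : Continuous fun x => flux Φ (u.1 x) (v.1 x) :=
  h.continuous.comp (u.2.1.continuous.prodMk v.2.1.continuous)

theorem abs_integral_flux_sub_le {Φ : ℝ → ℝ} {M : ℝ} (hM : 0 ≤ M) (h : FluxLipschitz Φ M)
    (u v u' v' φ : PerSmooth L₁ L₂) :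
    |∫ x, flux Φ (u.1 x) (v.1 x) * φ.1 x ∂boxMeasure L₁ L₂
        - ∫ x, flux Φ (u'.1 x) (v'.1 x) * φ.1 x ∂boxMeasure L₁ L₂| ≤
      M * (‖toL2 (u - u')‖ + ‖toL2 (v - v')‖) * ‖toL2 φ‖ := by
  have hc := h.continuous_comp u v
  have hc' := h.continuous_comp u' v'
  have hφ : Continuous φ.1 := φ.2.1.continuous
  have hu : Continuous (u - u').1 := (u - u').2.1.continuous
  have hv : Continuous (v - v').1 := (v - v').2.1.continuous
  rw [← integral_sub (integrable_box (hc.fun_mul hφ)) (integrable_box (hc'.fun_mul hφ))]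
  refine abs_integral_le_integral_abs.trans ?_
  calc _ ≤ ∫ x, (M * (|(u - u').1 x| * |φ.1 x|) + M * (|(v - v').1 x| * |φ.1 x|))
          ∂boxMeasure L₁ L₂ := by
        refine integral_mono (integrable_box (by fun_prop)) (integrable_box (by fun_prop))
          fun x => ?_
        beta_reduce
        rw [← sub_mul, abs_mul]
        have := mul_le_mul_of_nonneg_right (h (u.1 x) (v.1 x) (u'.1 x) (v'.1 x))
          (abs_nonneg (φ.1 x))
        refine this.trans_eq ?_
        change _ = M * (|u.1 x - u'.1 x| * |φ.1 x|) + M * (|v.1 x - v'.1 x| * |φ.1 x|)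
        ring
    _ ≤ M * (‖toL2 (u - u')‖ * ‖toL2 φ‖) + M * (‖toL2 (v - v')‖ * ‖toL2 φ‖) := by
        rw [integral_add (integrable_box (by fun_prop)) (integrable_box (by fun_prop)),
          integral_const_mul, integral_const_mul]
        gcongr <;> exact integral_abs_mul_abs_le _ _
    _ = _ := by ring

/-- A derivative can be moved from `φ` onto the current `Φ(|m|) m` evaluated at smooth periodic
functions. The current need not be smooth: the estimate holds for difference quotients by the
Lipschitz bound, and passes to the limit by dominated convergence. -/
theorem abs_integral_flux_mul_pd_le (hL₁ : 0 < L₁) (hL₂ : 0 < L₂) {Φ : ℝ → ℝ} {M : ℝ}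
    (hM : 0 ≤ M) (h : FluxLipschitz Φ M) (u v φ : PerSmooth L₁ L₂) (e : ℝ × ℝ) :
    |∫ x, flux Φ (u.1 x) (v.1 x) * (pd e φ).1 x ∂boxMeasure L₁ L₂| ≤
      M * (‖toL2 (pd e u)‖ + ‖toL2 (pd e v)‖) * ‖toL2 φ‖ := by
  set F : ℝ × ℝ → ℝ := fun x => flux Φ (u.1 x) (v.1 x) with hFdef
  have hF : Continuous F := h.continuous_comp u v
  have hφ : Continuous φ.1 := φ.2.1.continuous
  have hu : Continuous u.1 := u.2.1.continuous
  have hv : Continuous v.1 := v.2.1.continuous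
  have hp : ∀ x, F (x + (L₁, 0)) = F x ∧ F (x + (0, L₂)) = F x := fun x => by
    simp only [hFdef, (u.2.2 x).1, (u.2.2 x).2, (v.2.2 x).1, (v.2.2 x).2, and_self]
  have hneg : ∀ w : PerSmooth L₁ L₂, ∀ x, |(pd (-e) w).1 x| = |(pd e w).1 x| := fun w x => by
    change |fderiv ℝ w.1 x (-e)| = |fderiv ℝ w.1 x e|
    rw [map_neg, abs_neg]
  obtain ⟨A, hA⟩ := diffQuot_bounded hL₁ hL₂ φ e
  obtain ⟨B, hB⟩ := diffQuot_bounded hL₁ hL₂ u (-e)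
  obtain ⟨C, hC⟩ := diffQuot_bounded hL₁ hL₂ v (-e)
  have hdu := fun t => continuous_diffQuot hu (-e) t
  have hdv := fun t => continuous_diffQuot hv (-e) t
  have lim1 : Filter.Tendsto (fun t => ∫ x, F x * diffQuot φ.1 e t x ∂boxMeasure L₁ L₂)
      (nhdsWithin 0 {0}ᶜ) (nhds (∫ x, F x * (pd e φ).1 x ∂boxMeasure L₁ L₂)) := by
    refine tendsto_integral_filter_of_dominated_convergence (fun x => |F x| * A)
      (.of_forall fun t => (hF.mul (continuous_diffQuot hφ e t)).aestronglyMeasurable)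
      (.of_forall fun t => .of_forall fun x => ?_) (integrable_box (by fun_prop))
      (.of_forall fun x => (tendsto_diffQuot φ e x).const_mul _)
    rw [Real.norm_eq_abs, abs_mul]
    exact mul_le_mul_of_nonneg_left (hA t x) (abs_nonneg _)
  have lim2 : Filter.Tendsto (fun t => ∫ x, M * (|diffQuot u.1 (-e) t x| + |diffQuot v.1 (-e) t x|)
        * |φ.1 x| ∂boxMeasure L₁ L₂)
      (nhdsWithin 0 {0}ᶜ) (nhds (∫ x, M * (|(pd e u).1 x| + |(pd e v).1 x|) * |φ.1 x|
        ∂boxMeasure L₁ L₂)) := by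
    refine tendsto_integral_filter_of_dominated_convergence (fun x => M * (B + C) * |φ.1 x|)
      (.of_forall fun t => Continuous.aestronglyMeasurable (by fun_prop))
      (.of_forall fun t => .of_forall fun x => ?_) (integrable_box (by fun_prop))
      (.of_forall fun x => ?_)
    · rw [Real.norm_eq_abs, abs_of_nonneg (by positivity)]
      gcongr
      · exact hB t x
      · exact hC t x
    · rw [← hneg u, ← hneg v]
      exact (((tendsto_diffQuot u (-e) x).abs.add (tendsto_diffQuot v (-e) x).abs).const_mul
        M).mul_const _
  have hle : ∀ t, |∫ x, F x * diffQuot φ.1 e t x ∂boxMeasure L₁ L₂| ≤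
      ∫ x, M * (|diffQuot u.1 (-e) t x| + |diffQuot v.1 (-e) t x|) * |φ.1 x|
        ∂boxMeasure L₁ L₂ := fun t => by
    rw [integral_mul_diffQuot hL₁ hL₂ hF hp]
    refine abs_integral_le_integral_abs.trans
      (integral_mono (integrable_box ((continuous_diffQuot hF _ t).mul hφ).abs)
        (integrable_box (by fun_prop)) fun x => ?_)
    beta_reduce
    rw [abs_mul]
    gcongr
    simp only [diffQuot, abs_mul]
    have := mul_le_mul_of_nonneg_left (h (u.1 (x + t • -e)) (v.1 (x + t • -e)) (u.1 x) (v.1 x))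
      (abs_nonneg t⁻¹)
    refine this.trans_eq ?_
    ring
  refine (le_of_tendsto_of_tendsto lim1.abs lim2 (.of_forall hle)).trans ?_
  have hpu : Continuous (pd e u).1 := (pd e u).2.1.continuous
  have hpv : Continuous (pd e v).1 := (pd e v).2.1.continuous
  calc _ = M * (∫ x, |(pd e u).1 x| * |φ.1 x| ∂boxMeasure L₁ L₂
        + ∫ x, |(pd e v).1 x| * |φ.1 x| ∂boxMeasure L₁ L₂) := by
        rw [← integral_add (integrable_box (by fun_prop)) (integrable_box (by fun_prop)),
          ← integral_const_mul]
        congr 1; ext x; ring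
    _ ≤ M * (‖toL2 (pd e u)‖ * ‖toL2 φ‖ + ‖toL2 (pd e v)‖ * ‖toL2 φ‖) := by
        gcongr <;> exact integral_abs_mul_abs_le _ _
    _ = _ := by ring

/-- The nonlinear form `⟨Φ(|∇h|) ∇h, ∇φ⟩`. -/
def fluxForm (Φ : ℝ → ℝ) (h φ : PerSmooth L₁ L₂) : ℝ :=
  ∫ x, Φ (gradNorm h x) * gradDot h φ x ∂boxMeasure L₁ L₂

theorem fluxForm_eq {Φ : ℝ → ℝ} {M : ℝ} (hΦ : FluxLipschitz Φ M) (h φ : PerSmooth L₁ L₂) :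
    fluxForm Φ h φ =
      ∫ x, flux Φ ((pd₁ h).1 x) ((pd₂ h).1 x) * (pd₁ φ).1 x ∂boxMeasure L₁ L₂
      + ∫ x, flux Φ ((pd₂ h).1 x) ((pd₁ h).1 x) * (pd₂ φ).1 x ∂boxMeasure L₁ L₂ := by
  have h1 := hΦ.continuous_comp (pd₁ h) (pd₂ h)
  have h2 := hΦ.continuous_comp (pd₂ h) (pd₁ h)
  rw [← integral_add (integrable_box (h1.fun_mul (pd₁ φ).2.1.continuous))
    (integrable_box (h2.fun_mul (pd₂ φ).2.1.continuous))]
  unfold fluxForm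
  congr 1; ext x
  unfold flux gradNorm gradDot
  rw [add_comm (((pd₂ h).1 x) ^ 2)]
  ring

theorem abs_fluxForm_sub_le {Φ : ℝ → ℝ} {M : ℝ} (hM : 0 ≤ M) (hΦ : FluxLipschitz Φ M)
    (h g φ : PerSmooth L₁ L₂) :
    |fluxForm Φ h φ - fluxForm Φ g φ| ≤ M * (‖toL2 (pd₁ (h - g))‖ + ‖toL2 (pd₂ (h - g))‖)
      * (‖toL2 (pd₁ φ)‖ + ‖toL2 (pd₂ φ)‖) := by
  rw [fluxForm_eq hΦ, fluxForm_eq hΦ, add_sub_add_comm, map_sub pd₁, map_sub pd₂]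
  refine (abs_add_le _ _).trans ((add_le_add (abs_integral_flux_sub_le hM hΦ _ _ _ _ _)
    (abs_integral_flux_sub_le hM hΦ _ _ _ _ _)).trans_eq ?_)
  ring

theorem fluxForm_zero (Φ : ℝ → ℝ) (φ : PerSmooth L₁ L₂) : fluxForm Φ 0 φ = 0 := by
  simp [fluxForm, gradDot]

theorem abs_fluxForm_self_le {Φ : ℝ → ℝ} {M : ℝ} (hM : 0 ≤ M) (hΦ : FluxLipschitz Φ M)
    (h : PerSmooth L₁ L₂) :
    |fluxForm Φ h h| ≤ 2 * M * (‖toL2 h‖ * ‖toL2 (lap h)‖) := by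
  have h1 := abs_fluxForm_sub_le hM hΦ h 0 h
  rw [fluxForm_zero, sub_zero, sub_zero] at h1
  have h2 := norm_grad_sq_le h
  have h3 : (‖toL2 (pd₁ h)‖ + ‖toL2 (pd₂ h)‖) * (‖toL2 (pd₁ h)‖ + ‖toL2 (pd₂ h)‖) ≤
      2 * (‖toL2 h‖ * ‖toL2 (lap h)‖) := by
    nlinarith [sq_nonneg (‖toL2 (pd₁ h)‖ - ‖toL2 (pd₂ h)‖)]
  rw [mul_assoc] at h1
  refine h1.trans ((mul_le_mul_of_nonneg_left h3 hM).trans_eq ?_)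
  ring

/-- In weak form, `div (Φ(|∇h|) ∇h)` is bounded in `L²` by `Δh`. -/
theorem abs_fluxForm_le (hL₁ : 0 < L₁) (hL₂ : 0 < L₂) {Φ : ℝ → ℝ} {M : ℝ} (hM : 0 ≤ M)
    (hΦ : FluxLipschitz Φ M) (h φ : PerSmooth L₁ L₂) :
    |fluxForm Φ h φ| ≤ 4 * M * ‖toL2 (lap h)‖ * ‖toL2 φ‖ := by
  have h1 := abs_integral_flux_mul_pd_le hL₁ hL₂ hM hΦ (pd₁ h) (pd₂ h) φ (1, 0)
  have h2 := abs_integral_flux_mul_pd_le hL₁ hL₂ hM hΦ (pd₂ h) (pd₁ h) φ (0, 1)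
  have h3 := norm_lap_sq h
  have hle : ∀ a : ℝ, a ^ 2 ≤ ‖toL2 (lap h)‖ ^ 2 → a ≤ ‖toL2 (lap h)‖ := fun a ha =>
    le_of_abs_le (abs_le_of_sq_le_sq ha (norm_nonneg _))
  have a1 := hle ‖toL2 (pd₁ (pd₁ h))‖ (by
    nlinarith [sq_nonneg ‖toL2 (pd₂ (pd₂ h))‖, sq_nonneg ‖toL2 (pd₁ (pd₂ h))‖])
  have a2 := hle ‖toL2 (pd₂ (pd₂ h))‖ (by
    nlinarith [sq_nonneg ‖toL2 (pd₁ (pd₁ h))‖, sq_nonneg ‖toL2 (pd₁ (pd₂ h))‖])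
  have a3 := hle ‖toL2 (pd₁ (pd₂ h))‖ (by
    nlinarith [sq_nonneg ‖toL2 (pd₁ (pd₁ h))‖, sq_nonneg ‖toL2 (pd₂ (pd₂ h))‖])
  change |_| ≤ M * (‖toL2 (pd₁ (pd₁ h))‖ + ‖toL2 (pd₁ (pd₂ h))‖) * _ at h1
  change |_| ≤ M * (‖toL2 (pd₂ (pd₂ h))‖ + ‖toL2 (pd₂ (pd₁ h))‖) * _ at h2
  rw [← pd₁_pd₂] at h2
  rw [fluxForm_eq hΦ]
  refine (abs_add_le _ _).trans ((add_le_add h1 h2).trans ?_)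
  calc _ ≤ M * (‖toL2 (lap h)‖ + ‖toL2 (lap h)‖) * ‖toL2 φ‖
        + M * (‖toL2 (lap h)‖ + ‖toL2 (lap h)‖) * ‖toL2 φ‖ := by gcongr
    _ = _ := by ring

theorem integral_mul_eq_inner (f g : PerSmooth L₁ L₂) :
    ∫ x, f.1 x * g.1 x ∂boxMeasure L₁ L₂ = inner ℝ (toL2 f) (toL2 g) :=
  (inner_toL2 f g).symm

theorem aForm_eq (γ ε : ℝ) (Φ : ℝ → ℝ) (h φ : PerSmooth L₁ L₂) :
    aForm γ ε Φ h φ = -γ * inner ℝ (toL2 (lap h)) (toL2 φ)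
      + ε ^ 2 * inner ℝ (toL2 (lap h)) (toL2 (lap φ)) - fluxForm Φ h φ := by
  have h1 : ∫ x, gradDot h φ x ∂boxMeasure L₁ L₂ = -inner ℝ (toL2 (lap h)) (toL2 φ) := by
    rw [inner_lap_left, neg_neg, ← integral_mul_eq_inner, ← integral_mul_eq_inner,
      ← integral_add (integrable_box ((pd₁ h).2.1.continuous.fun_mul (pd₁ φ).2.1.continuous))
        (integrable_box ((pd₂ h).2.1.continuous.fun_mul (pd₂ φ).2.1.continuous))]
    rfl
  rw [aForm, h1, integral_mul_eq_inner, fluxForm]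
  ring

/-! ### The Galerkin space -/

theorem toL2_injective (hL₁ : 0 < L₁) (hL₂ : 0 < L₂) :
    Function.Injective (toL2 : PerSmooth L₁ L₂ →ₗ[ℝ] L2 L₁ L₂) := by
  intro f g hfg
  have h1 : f.1 =ᵐ[boxMeasure L₁ L₂] g.1 := ((perMemLp f).toLp_eq_toLp_iff (perMemLp g)).1 hfg
  have h2 : EqOn f.1 g.1 (Ioo 0 L₁ ×ˢ Ioo 0 L₂) :=
    Measure.eqOn_open_of_ae_eq h1 (isOpen_Ioo.prod isOpen_Ioo) f.2.1.continuous.continuousOn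
      g.2.1.continuous.continuousOn
  have h3 := h2.closure f.2.1.continuous g.2.1.continuous
  rw [closure_prod_eq, closure_Ioo hL₁.ne, closure_Ioo hL₂.ne] at h3
  refine Subtype.ext (funext fun x => ?_)
  obtain ⟨y, hy, hyx⟩ := periodic_exists_mem_box hL₁ hL₂ (f := fun x => f.1 x - g.1 x)
    (fun x => by
      simp only [(f.2.2 x).1, (g.2.2 x).1, (f.2.2 x).2, (g.2.2 x).2, and_self]) x
  have := h3 hy
  linarith

theorem hasFDerivAt_phase (ξ : ℤ × ℤ) (x : ℝ × ℝ) :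
    ∃ A : ℝ × ℝ →L[ℝ] ℝ, HasFDerivAt (phase L₁ L₂ ξ) A x ∧ ∀ e, A e = phase L₁ L₂ ξ e := by
  let A : ℝ × ℝ →ₗ[ℝ] ℝ :=
    { toFun := phase L₁ L₂ ξ
      map_add' := fun x y => by simp only [phase, Prod.fst_add, Prod.snd_add]; ring
      map_smul' := fun c x => by
        simp only [phase, Prod.smul_fst, Prod.smul_snd, smul_eq_mul, RingHom.id_apply]; ring }
  exact ⟨A.toContinuousLinearMap, A.toContinuousLinearMap.hasFDerivAt, fun _ => rfl⟩

theorem pd_cosMode (e : ℝ × ℝ) (ξ : ℤ × ℤ) :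
    pd e (cosMode ξ : PerSmooth L₁ L₂) = (-phase L₁ L₂ ξ e) • sinMode ξ := by
  refine Subtype.ext (funext fun x => ?_)
  obtain ⟨A, hA, hAe⟩ := hasFDerivAt_phase (L₁ := L₁) (L₂ := L₂) ξ x
  change fderiv ℝ (fun x => Real.cos (phase L₁ L₂ ξ x)) x e =
    -phase L₁ L₂ ξ e * Real.sin (phase L₁ L₂ ξ x)
  rw [hA.cos.fderiv]
  simp [hAe]; ring

theorem pd_sinMode (e : ℝ × ℝ) (ξ : ℤ × ℤ) :
    pd e (sinMode ξ : PerSmooth L₁ L₂) = (phase L₁ L₂ ξ e) • cosMode ξ := by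
  refine Subtype.ext (funext fun x => ?_)
  obtain ⟨A, hA, hAe⟩ := hasFDerivAt_phase (L₁ := L₁) (L₂ := L₂) ξ x
  change fderiv ℝ (fun x => Real.sin (phase L₁ L₂ ξ x)) x e =
    phase L₁ L₂ ξ e * Real.cos (phase L₁ L₂ ξ x)
  rw [hA.sin.fderiv]
  simp [hAe]; ring

theorem pd_oneMode (e : ℝ × ℝ) : pd e (oneMode : PerSmooth L₁ L₂) = 0 := by
  refine Subtype.ext (funext fun x => ?_)
  change fderiv ℝ (fun _ => (1 : ℝ)) x e = 0
  simp

/-- Derivatives exchange `cos (ξ · x̃)` and `sin (ξ · x̃)`, so they preserve `H_N`. -/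
theorem pd_mem_trigSpace (e : ℝ × ℝ) {I : Finset (ℤ × ℤ)} {φ : PerSmooth L₁ L₂}
    (hφ : φ ∈ trigSpace L₁ L₂ I) : pd e φ ∈ trigSpace L₁ L₂ I := by
  suffices h : trigSpace L₁ L₂ I ≤ (trigSpace L₁ L₂ I).comap (pd e) from h hφ
  refine Submodule.span_le.2 ?_
  rintro _ ((rfl | ⟨ξ, hξ, rfl⟩) | ⟨ξ, hξ, rfl⟩)
  · change pd e oneMode ∈ trigSpace L₁ L₂ I
    rw [pd_oneMode]; exact zero_mem _
  · change pd e (cosMode ξ) ∈ trigSpace L₁ L₂ I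
    rw [pd_cosMode]
    exact Submodule.smul_mem _ _ (Submodule.subset_span (Or.inr ⟨ξ, hξ, rfl⟩))
  · change pd e (sinMode ξ) ∈ trigSpace L₁ L₂ I
    rw [pd_sinMode]
    exact Submodule.smul_mem _ _ (Submodule.subset_span (Or.inl (Or.inr ⟨ξ, hξ, rfl⟩)))

theorem lap_mem_trigSpace {I : Finset (ℤ × ℤ)} {φ : PerSmooth L₁ L₂}
    (hφ : φ ∈ trigSpace L₁ L₂ I) : lap φ ∈ trigSpace L₁ L₂ I := by
  rw [lap_apply]
  exact add_mem (pd_mem_trigSpace _ (pd_mem_trigSpace _ hφ))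
    (pd_mem_trigSpace _ (pd_mem_trigSpace _ hφ))

/-- `H_N` as a subspace of `L²(Ω)`. -/
abbrev galerkinL2 (L₁ L₂ : ℝ) (I : Finset (ℤ × ℤ)) : Submodule ℝ (L2 L₁ L₂) :=
  (trigSpace L₁ L₂ I).map toL2

/-- The element of `H_N` with a given class in `L²(Ω)`. -/
def lift (hL₁ : 0 < L₁) (hL₂ : 0 < L₂) (I : Finset (ℤ × ℤ)) :
    galerkinL2 L₁ L₂ I →ₗ[ℝ] PerSmooth L₁ L₂ :=
  (trigSpace L₁ L₂ I).subtype ∘ₗ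
    ((trigSpace L₁ L₂ I).equivMapOfInjective toL2 (toL2_injective hL₁ hL₂)).symm.toLinearMap

theorem lift_mem (hL₁ : 0 < L₁) (hL₂ : 0 < L₂) (I : Finset (ℤ × ℤ))
    (y : galerkinL2 L₁ L₂ I) : lift hL₁ hL₂ I y ∈ trigSpace L₁ L₂ I :=
  Subtype.property _

theorem toL2_lift (hL₁ : 0 < L₁) (hL₂ : 0 < L₂) (I : Finset (ℤ × ℤ))
    (y : galerkinL2 L₁ L₂ I) : toL2 (lift hL₁ hL₂ I y) = y := by
  have h := ((trigSpace L₁ L₂ I).equivMapOfInjective toL2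
    (toL2_injective hL₁ hL₂)).apply_symm_apply y
  exact congrArg Subtype.val h

theorem lift_toL2 (hL₁ : 0 < L₁) (hL₂ : 0 < L₂) (I : Finset (ℤ × ℤ))
    {φ : PerSmooth L₁ L₂} (hφ : φ ∈ trigSpace L₁ L₂ I) :
    lift hL₁ hL₂ I ⟨toL2 φ, Submodule.mem_map_of_mem hφ⟩ = φ :=
  toL2_injective hL₁ hL₂ (toL2_lift hL₁ hL₂ I _)

/-- On the finite-dimensional space `H_N` every linear map is continuous for the `L²` norm. -/
theorem exists_clm_eq_on_trigSpace (hL₁ : 0 < L₁) (hL₂ : 0 < L₂) (I : Finset (ℤ × ℤ))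
    {F : Type*} [NormedAddCommGroup F] [NormedSpace ℝ F]
    (S : PerSmooth L₁ L₂ →ₗ[ℝ] F) :
    ∃ A : L2 L₁ L₂ →L[ℝ] F, ∀ φ ∈ trigSpace L₁ L₂ I, A (toL2 φ) = S φ := by
  refine ⟨(S ∘ₗ lift hL₁ hL₂ I).toContinuousLinearMap.comp
    (galerkinL2 L₁ L₂ I).orthogonalProjectionOnto, fun φ hφ => ?_⟩
  have h := Submodule.orthogonalProjectionOnto_mem_subspace_eq_self
    (K := galerkinL2 L₁ L₂ I) ⟨toL2 φ, Submodule.mem_map_of_mem hφ⟩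
  simp only [ContinuousLinearMap.comp_apply, h]
  exact congrArg S (lift_toL2 hL₁ hL₂ I hφ)

/-- On `H_N` the nonlinear operator `h ↦ a(h, ·)` is Lipschitz for the `L²` norm, with a constant
that depends on `N`. -/
theorem exists_aForm_lipschitz (hL₁ : 0 < L₁) (hL₂ : 0 < L₂) (I : Finset (ℤ × ℤ))
    (γ ε : ℝ) {Φ : ℝ → ℝ} {M : ℝ} (hM : 0 ≤ M)
    (hΦ : FluxLipschitz Φ M) :
    ∃ K : NNReal, ∀ f ∈ trigSpace L₁ L₂ I, ∀ g ∈ trigSpace L₁ L₂ I, ∀ φ ∈ trigSpace L₁ L₂ I,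
      |aForm γ ε Φ f φ - aForm γ ε Φ g φ| ≤ K * ‖toL2 (f - g)‖ * ‖toL2 φ‖ := by
  obtain ⟨A, hA⟩ := exists_clm_eq_on_trigSpace hL₁ hL₂ I (toL2 ∘ₗ lap)
  obtain ⟨B, hB⟩ := exists_clm_eq_on_trigSpace hL₁ hL₂ I (toL2 ∘ₗ pd₁)
  obtain ⟨C, hC⟩ := exists_clm_eq_on_trigSpace hL₁ hL₂ I (toL2 ∘ₗ pd₂)
  refine ⟨⟨|γ| * ‖A‖ + ε ^ 2 * (‖A‖ * ‖A‖) + M * (‖B‖ + ‖C‖) * (‖B‖ + ‖C‖), by positivity⟩,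
    fun f hf g hg φ hφ => ?_⟩
  have hfg : f - g ∈ trigSpace L₁ L₂ I := sub_mem hf hg
  have a : ∀ ψ ∈ trigSpace L₁ L₂ I, ‖toL2 (lap ψ)‖ ≤ ‖A‖ * ‖toL2 ψ‖ := fun ψ hψ =>
    (congrArg norm (hA ψ hψ)).symm.le.trans (A.le_opNorm _)
  have b : ∀ ψ ∈ trigSpace L₁ L₂ I, ‖toL2 (pd₁ ψ)‖ ≤ ‖B‖ * ‖toL2 ψ‖ := fun ψ hψ =>
    (congrArg norm (hB ψ hψ)).symm.le.trans (B.le_opNorm _)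
  have c : ∀ ψ ∈ trigSpace L₁ L₂ I, ‖toL2 (pd₂ ψ)‖ ≤ ‖C‖ * ‖toL2 ψ‖ := fun ψ hψ =>
    (congrArg norm (hC ψ hψ)).symm.le.trans (C.le_opNorm _)
  have h1 := abs_fluxForm_sub_le hM hΦ f g φ
  have e : aForm γ ε Φ f φ - aForm γ ε Φ g φ =
      -γ * inner ℝ (toL2 (lap (f - g))) (toL2 φ)
        + ε ^ 2 * inner ℝ (toL2 (lap (f - g))) (toL2 (lap φ))
        - (fluxForm Φ f φ - fluxForm Φ g φ) := by
    simp only [aForm_eq, map_sub, inner_sub_left]; ring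
  have h2 := abs_real_inner_le_norm (toL2 (lap (f - g))) (toL2 φ)
  have h3 := abs_real_inner_le_norm (toL2 (lap (f - g))) (toL2 (lap φ))
  rw [e]
  calc _ ≤ |γ| * |inner ℝ (toL2 (lap (f - g))) (toL2 φ)|
        + ε ^ 2 * |inner ℝ (toL2 (lap (f - g))) (toL2 (lap φ))|
        + |fluxForm Φ f φ - fluxForm Φ g φ| := by
        refine (abs_sub _ _).trans (add_le_add_left ((abs_add_le _ _).trans ?_) _)
        rw [abs_mul, abs_mul, abs_neg, abs_of_nonneg (sq_nonneg ε)]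
    _ ≤ |γ| * ((‖A‖ * ‖toL2 (f - g)‖) * ‖toL2 φ‖)
        + ε ^ 2 * ((‖A‖ * ‖toL2 (f - g)‖) * (‖A‖ * ‖toL2 φ‖))
        + M * (‖B‖ * ‖toL2 (f - g)‖ + ‖C‖ * ‖toL2 (f - g)‖)
          * (‖B‖ * ‖toL2 φ‖ + ‖C‖ * ‖toL2 φ‖) := by
        gcongr
        · exact h2.trans (by gcongr; exact a _ hfg)
        · exact h3.trans (by gcongr; exacts [a _ hfg, a _ hφ])
        · exact h1.trans (by gcongr; exacts [b _ hfg, c _ hfg, b _ hφ, c _ hφ])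
    _ = (|γ| * ‖A‖ + ε ^ 2 * (‖A‖ * ‖A‖) + M * (‖B‖ + ‖C‖) * (‖B‖ + ‖C‖))
          * ‖toL2 (f - g)‖ * ‖toL2 φ‖ := by ring

theorem fluxForm_add {Φ : ℝ → ℝ} {M : ℝ} (hΦ : FluxLipschitz Φ M) (h φ ψ : PerSmooth L₁ L₂) :
    fluxForm Φ h (φ + ψ) = fluxForm Φ h φ + fluxForm Φ h ψ := by
  have h1 := hΦ.continuous_comp (pd₁ h) (pd₂ h)
  have h2 := hΦ.continuous_comp (pd₂ h) (pd₁ h)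
  have i1 := fun χ : PerSmooth L₁ L₂ =>
    integrable_box (L₁ := L₁) (L₂ := L₂) (h1.fun_mul (pd₁ χ).2.1.continuous)
  have i2 := fun χ : PerSmooth L₁ L₂ =>
    integrable_box (L₁ := L₁) (L₂ := L₂) (h2.fun_mul (pd₂ χ).2.1.continuous)
  simp only [fluxForm_eq hΦ, map_add, Submodule.coe_add, Pi.add_apply, mul_add]
  rw [integral_add (i1 _) (i1 _), integral_add (i2 _) (i2 _)]
  ring

theorem fluxForm_smul {Φ : ℝ → ℝ} {M : ℝ} (hΦ : FluxLipschitz Φ M) (c : ℝ)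
    (h φ : PerSmooth L₁ L₂) : fluxForm Φ h (c • φ) = c * fluxForm Φ h φ := by
  simp only [fluxForm_eq hΦ, map_smul, Submodule.coe_smul, Pi.smul_apply, smul_eq_mul,
    mul_left_comm _ c, integral_const_mul, mul_add]

/-- The form `a(h, ·)` as a linear functional. -/
def aFunctional (γ ε : ℝ) {Φ : ℝ → ℝ} {M : ℝ} (hΦ : FluxLipschitz Φ M) (h : PerSmooth L₁ L₂) :
    PerSmooth L₁ L₂ →ₗ[ℝ] ℝ where
  toFun := aForm γ ε Φ h
  map_add' φ ψ := by
    simp only [aForm_eq, fluxForm_add hΦ, map_add, inner_add_right]; ring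
  map_smul' c φ := by
    simp only [aForm_eq, fluxForm_smul hΦ, map_smul, real_inner_smul_right, RingHom.id_apply,
      smul_eq_mul]
    ring

instance (T : ℝ) : IsFiniteMeasure (timeMeasure T) := by
  unfold timeMeasure; infer_instance

/-- The Galerkin problem is an ordinary differential equation in `H_N` with a Lipschitz vector field
and a source that is integrable in time; its integral form is solved by `exists_integral_equation`,
and the solution is differentiable almost everywhere by Lebesgue's theorem. -/
theorem exists_isGalerkinSolution (hL₁ : 0 < L₁) (hL₂ : 0 < L₂) {T : ℝ} (hT : 0 < T) (γ ε : ℝ)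
    {Φ : ℝ → ℝ} {M : ℝ} (hM : 0 ≤ M) (hΦ : FluxLipschitz Φ M) (I : Finset (ℤ × ℤ))
    (h₀ : L2 L₁ L₂) (ζ : Lp (HperDual L₁ L₂ 2) 2 (timeMeasure T)) :
    ∃ h : ℝ → PerSmooth L₁ L₂, IsGalerkinSolution γ ε Φ T I h₀ ζ h := by
  let E := galerkinL2 L₁ L₂ I
  let R := lift hL₁ hL₂ I
  have hR : ∀ y, R y ∈ trigSpace L₁ L₂ I := lift_mem hL₁ hL₂ I
  have hR2 : ∀ y, toL2 (R y) = y := toL2_lift hL₁ hL₂ I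
  -- The Riesz representatives of `-a(h, ·)` and of the source in `H_N`.
  let G : E → E := fun y => (InnerProductSpace.toDual ℝ E).symm
    (-(aFunctional γ ε hΦ (R y) ∘ₗ R).toContinuousLinearMap)
  have hG : ∀ y z, inner ℝ (G y) z = -aForm γ ε Φ (R y) (R z) := fun y z => by
    rw [InnerProductSpace.toDual_symm_apply]; rfl
  let H : E →L[ℝ] Hper L₁ L₂ 2 := (toHper 2 ∘ₗ R).toContinuousLinearMap
  let f : ℝ → E := fun t => (InnerProductSpace.toDual ℝ E).symm ((ζ t).comp H)
  have hf : ∀ t z, inner ℝ (f t) z = ζ t (toHper 2 (R z)) := fun t z => by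
    rw [InnerProductSpace.toDual_symm_apply]; rfl
  obtain ⟨K, hK⟩ := exists_aForm_lipschitz hL₁ hL₂ I γ ε hM hΦ
  have hGL : LipschitzWith K G := by
    refine LipschitzWith.of_dist_le_mul fun y z => ?_
    rw [dist_eq_norm, dist_eq_norm]
    set d := G y - G z with hd
    have h1 : ‖d‖ * ‖d‖ ≤ K * ‖y - z‖ * ‖d‖ := by
      have h2 := hK (R y) (hR y) (R z) (hR z) (R d) (hR d)
      have e1 : ‖toL2 (R y - R z)‖ = ‖y - z‖ := by rw [← map_sub, hR2]; rfl
      have e2 : ‖toL2 (R d)‖ = ‖d‖ := by rw [hR2]; rfl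
      rw [e1, e2] at h2
      rw [← real_inner_self_eq_norm_mul_norm]
      nth_rewrite 1 [hd]
      rw [inner_sub_left, hG, hG]
      refine le_trans ?_ h2
      rw [abs_sub_comm]
      refine le_trans (le_of_eq ?_) (le_abs_self _)
      ring
    rcases (norm_nonneg d).eq_or_lt with h0 | h0
    · rw [← h0]; positivity
    · exact le_of_mul_le_mul_right h1 h0
  have hfi : IntervalIntegrable f volume 0 T := by
    rw [intervalIntegrable_iff_integrableOn_Ioo_of_le hT.le]
    have hζ := (Lp.memLp ζ).integrable one_le_two
    have hcont : Continuous fun l : HperDual L₁ L₂ 2 =>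
        (InnerProductSpace.toDual ℝ E).symm (l.comp H) :=
      (InnerProductSpace.toDual ℝ E).symm.continuous.comp
        (continuous_id.clm_comp continuous_const)
    refine Integrable.mono' (hζ.norm.mul_const ‖H‖) (hcont.comp_aestronglyMeasurable hζ.1)
      (.of_forall fun t => ?_)
    rw [LinearIsometryEquiv.norm_map]
    exact ContinuousLinearMap.opNorm_comp_le _ _
  let y₀ : E := (galerkinL2 L₁ L₂ I).orthogonalProjectionOnto h₀
  obtain ⟨y, hyc, hy⟩ := exists_integral_equation hGL (F := fun t => y₀ + ∫ s in (0)..t, f s) hT.le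
    (by
      have := intervalIntegral.continuousOn_primitive_interval (a := 0) (b := T) (μ := volume)
        (f := f) (by
          rw [uIcc_of_le hT.le]
          exact (intervalIntegrable_iff_integrableOn_Icc_of_le hT.le).1 hfi)
      rw [uIcc_of_le hT.le] at this
      exact continuousOn_const.add this)
  have hGi : IntervalIntegrable (fun s => G (y s)) volume 0 T :=
    ContinuousOn.intervalIntegrable (by
      rw [uIcc_of_le hT.le]; exact hGL.continuous.comp_continuousOn hyc)
  let g : ℝ → E := fun s => f s + G (y s)
  have hg : IntervalIntegrable g volume 0 T := hfi.add hGi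
  -- `Y` agrees with `y` on `[0, T]` and is defined by an integral on the whole line.
  let Y : ℝ → E := fun t => y₀ + ∫ s in (0)..t, g s
  have hsub : ∀ t ∈ Icc 0 T, uIcc 0 t ⊆ uIcc 0 T := fun t ht => by
    rw [uIcc_of_le ht.1, uIcc_of_le hT.le]; exact Icc_subset_Icc_right ht.2
  have hYy : ∀ t ∈ Icc 0 T, Y t = y t := fun t ht => by
    change y₀ + ∫ s in (0)..t, g s = y t
    rw [hy t ht, intervalIntegral.integral_add (hfi.mono_set (hsub t ht))
      (hGi.mono_set (hsub t ht)), add_assoc]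
  have hYd : ∀ᵐ t ∂timeMeasure T, HasDerivAt (fun t => toL2 (R (Y t))) (g t : L2 L₁ L₂) t := by
    rw [timeMeasure, ae_restrict_iff' measurableSet_Ioo]
    filter_upwards [hg.ae_hasDerivAt_integral] with t ht hmem
    rw [uIcc_of_le hT.le] at ht
    have h1 : HasDerivAt Y (g t) t :=
      (ht (Ioo_subset_Icc_self hmem) 0 ⟨le_rfl, hT.le⟩).const_add y₀
    simp only [hR2]
    exact (galerkinL2 L₁ L₂ I).subtypeL.hasFDerivAt.comp_hasDerivAt t h1
  refine ⟨fun t => R (Y t), fun t _ => hR _, ?_, ?_, ?_, ?_⟩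
  · have hp := hg.norm.absolutelyContinuousOnInterval_intervalIntegral (c := 0) left_mem_uIcc
    refine absolutelyContinuousOnInterval_of_dist_le (C := 1) hp fun s hs t ht => ?_
    rw [uIcc_of_le hT.le] at hs ht
    have e : toL2 (R (Y s)) - toL2 (R (Y t)) = ((∫ r in t..s, g r : E) : L2 L₁ L₂) := by
      rw [← intervalIntegral.integral_interval_sub_left (hg.mono_set (hsub s hs))
        (hg.mono_set (hsub t ht)), hR2, hR2]
      simp [Y]
    rw [dist_eq_norm, e, Real.dist_eq, one_mul,
      intervalIntegral.integral_interval_sub_left (hg.norm.mono_set (hsub s hs))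
        (hg.norm.mono_set (hsub t ht))]
    exact intervalIntegral.norm_integral_le_abs_integral_norm (f := g)
  · rw [hR2]
    simp [Y, proj, y₀]
  · filter_upwards [hYd] with t ht using ht.differentiableAt
  · filter_upwards [hYd, ae_restrict_mem measurableSet_Ioo] with t ht hmem φ hφ
    rw [ht.deriv, hYy t (Ioo_subset_Icc_self hmem)]
    have h1 : inner ℝ (g t : L2 L₁ L₂) (toL2 φ) =
        inner ℝ (g t) (⟨toL2 φ, Submodule.mem_map_of_mem hφ⟩ : E) := rfl
    have h2 : R ⟨toL2 φ, Submodule.mem_map_of_mem hφ⟩ = φ := lift_toL2 hL₁ hL₂ I hφ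
    rw [h1, inner_add_left, hf, hG, h2]
    ring

/-- The time derivative of a Galerkin solution belongs to `H_N`, because `H_N` is closed in `L²(Ω)`;
it is therefore an admissible test function. -/
theorem IsGalerkinSolution.hasDerivAt {γ ε T : ℝ} {Φ : ℝ → ℝ} {I : Finset (ℤ × ℤ)} {h₀ : L2 L₁ L₂}
    {ζ : Lp (HperDual L₁ L₂ 2) 2 (timeMeasure T)} {h : ℝ → PerSmooth L₁ L₂}
    (hs : IsGalerkinSolution γ ε Φ T I h₀ ζ h) :
    ∀ᵐ t ∂timeMeasure T, t ∈ Ioo 0 T ∧ h t ∈ trigSpace L₁ L₂ I ∧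
      ∃ ψ ∈ trigSpace L₁ L₂ I, HasDerivAt (fun t => toL2 (h t)) (toL2 ψ) t ∧
        ∀ φ ∈ trigSpace L₁ L₂ I,
          inner ℝ (toL2 ψ) (toL2 φ) = ζ t (toHper 2 φ) - aForm γ ε Φ (h t) φ := by
  filter_upwards [hs.diff, hs.eqn, ae_restrict_mem measurableSet_Ioo] with t h1 h2 h3
  refine ⟨h3, hs.mem t (Ioo_subset_Icc_self h3), ?_⟩
  -- Near `t` the solution is fixed by the projection onto `H_N`, hence so is its derivative.
  set P := (galerkinL2 L₁ L₂ I).starProjection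
  have h4 : deriv (fun t => toL2 (h t)) t ∈ galerkinL2 L₁ L₂ I := by
    rw [← Submodule.starProjection_eq_self_iff]
    have h5 : HasDerivAt (fun t => P (toL2 (h t))) (P (deriv (fun t => toL2 (h t)) t)) t :=
      P.hasFDerivAt.comp_hasDerivAt t h1.hasDerivAt
    refine h5.unique (h1.hasDerivAt.congr_of_eventuallyEq ?_)
    filter_upwards [Ioo_mem_nhds h3.1 h3.2] with s hs'
    exact Submodule.starProjection_eq_self_iff.2
      (Submodule.mem_map_of_mem (hs.mem s (Ioo_subset_Icc_self hs')))
  obtain ⟨ψ, hψ, e⟩ := h4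
  refine ⟨ψ, hψ, e ▸ h1.hasDerivAt, fun φ hφ => ?_⟩
  rw [e]
  linarith [h2 φ hφ]

/-- The difference `d` of two solutions satisfies `(‖d‖²)' ≤ 2 K ‖d‖²` and vanishes at time zero. -/
theorem IsGalerkinSolution.unique (hL₁ : 0 < L₁) (hL₂ : 0 < L₂) {γ ε T : ℝ} (hT : 0 < T)
    {Φ : ℝ → ℝ} {M : ℝ} (hM : 0 ≤ M) (hΦ : FluxLipschitz Φ M) {I : Finset (ℤ × ℤ)}
    {h₀ : L2 L₁ L₂} {ζ : Lp (HperDual L₁ L₂ 2) 2 (timeMeasure T)} {h g : ℝ → PerSmooth L₁ L₂}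
    (hh : IsGalerkinSolution γ ε Φ T I h₀ ζ h) (hg : IsGalerkinSolution γ ε Φ T I h₀ ζ g) :
    ∀ t ∈ Icc 0 T, h t = g t := by
  obtain ⟨K, hK⟩ := exists_aForm_lipschitz hL₁ hL₂ I γ ε hM hΦ
  have hae : ∀ᵐ t ∂volume.restrict (Ioo 0 T),
      deriv (fun t => ‖toL2 (h t) - toL2 (g t)‖ ^ 2) t + 0 ≤
        2 * K * ‖toL2 (h t) - toL2 (g t)‖ ^ 2 + 0 := by
    filter_upwards [hh.hasDerivAt, hg.hasDerivAt] with t h1 h2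
    obtain ⟨-, hm, ψ, hψ, hd, he⟩ := h1
    obtain ⟨-, hm', ψ', hψ', hd', he'⟩ := h2
    have hφ := sub_mem hm hm'
    rw [(hd.fun_sub hd').norm_sq.deriv, ← map_sub, real_inner_comm, inner_sub_left, he _ hφ,
      he' _ hφ]
    have h3 := neg_le_of_abs_le (hK _ hm _ hm' _ hφ)
    nlinarith
  intro t ht
  have h1 := energy_gronwall hT.le (by positivity : (0 : ℝ) ≤ 2 * K)
    (absolutelyContinuousOnInterval_norm_sq (hh.absCont.fun_sub hg.absCont))
    (fun t _ => sq_nonneg _) (d := fun _ => 0) (b := fun _ => 0) integrableOn_zero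
    (fun _ => le_rfl) integrableOn_zero (fun _ => le_rfl) hae t ht
  rw [hh.init, hg.init] at h1
  simp only [sub_self, norm_zero, integral_zero, add_zero, ne_eq, OfNat.ofNat_ne_zero,
    not_false_eq_true, zero_pow, mul_zero] at h1
  have h2 : ‖toL2 (h t) - toL2 (g t)‖ = 0 := by
    have := le_antisymm h1 (sq_nonneg _)
    simpa using this
  exact toL2_injective hL₁ hL₂ (sub_eq_zero.1 (norm_eq_zero.1 h2))

/-! ### Square integrals in time -/

theorem integrable_norm_sq_Lp {X F : Type*} [MeasurableSpace X] {μ : Measure X}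
    [NormedAddCommGroup F] (f : Lp F 2 μ) : Integrable (fun x => ‖f x‖ ^ 2) μ :=
  (memLp_two_iff_integrable_sq_norm (Lp.memLp f).1).1 (Lp.memLp f)

theorem integral_norm_sq_Lp {X F : Type*} [MeasurableSpace X] {μ : Measure X}
    [NormedAddCommGroup F] (f : Lp F 2 μ) : ∫ x, ‖f x‖ ^ 2 ∂μ = ‖f‖ ^ 2 := by
  have h0 : 0 ≤ ∫ x, ‖f x‖ ^ 2 ∂μ := integral_nonneg fun _ => sq_nonneg _
  rw [Lp.norm_def, (Lp.memLp f).eLpNorm_eq_integral_rpow_norm (by simp) (by simp)]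
  simp only [ENNReal.toReal_ofNat, Real.rpow_ofNat]
  rw [ENNReal.toReal_ofReal (by positivity), ← Real.rpow_natCast, ← Real.rpow_mul h0]
  norm_num

theorem eLpNorm_two_le_sqrt {X F : Type*} [MeasurableSpace X] {μ : Measure X}
    [NormedAddCommGroup F] {f : X → F} (hf : AEStronglyMeasurable f μ) {w : X → ℝ}
    (hw : Integrable w μ) (hfw : ∀ᵐ x ∂μ, ‖f x‖ ^ 2 ≤ w x) {c : ℝ} (hc : ∫ x, w x ∂μ ≤ c) :
    MemLp f 2 μ ∧ eLpNorm f 2 μ ≤ ENNReal.ofReal (Real.sqrt c) := by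
  have hi : Integrable (fun x => ‖f x‖ ^ 2) μ :=
    hw.mono' (hf.norm.pow 2) (by
      filter_upwards [hfw] with x hx
      rwa [Real.norm_of_nonneg (sq_nonneg _)])
  have hm := (memLp_two_iff_integrable_sq_norm hf).2 hi
  refine ⟨hm, ?_⟩
  rw [hm.eLpNorm_eq_integral_rpow_norm (by simp) (by simp)]
  simp only [ENNReal.toReal_ofNat, Real.rpow_ofNat]
  rw [Real.sqrt_eq_rpow, one_div]
  exact ENNReal.ofReal_le_ofReal (Real.rpow_le_rpow (integral_nonneg fun _ => sq_nonneg _)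
    ((integral_mono_ae hi hw hfw).trans hc) (by norm_num))

theorem eLpNorm_top_le_sqrt {X F : Type*} [MeasurableSpace X] {μ : Measure X} [IsFiniteMeasure μ]
    [NormedAddCommGroup F] {f : X → F} (hf : AEStronglyMeasurable f μ) {c : ℝ}
    (hc : ∀ᵐ x ∂μ, ‖f x‖ ^ 2 ≤ c) :
    MemLp f ⊤ μ ∧ eLpNorm f ⊤ μ ≤ ENNReal.ofReal (Real.sqrt c) := by
  have h : ∀ᵐ x ∂μ, ‖f x‖ ≤ Real.sqrt c := by
    filter_upwards [hc] with x hx using Real.le_sqrt_of_sq_le hx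
  refine ⟨MemLp.of_bound hf _ h, ?_⟩
  rw [eLpNorm_exponent_top]
  exact eLpNormEssSup_le_of_ae_bound h

/-! ### A priori estimates -/

section

variable {γ ε T : ℝ} {Φ : ℝ → ℝ} {I : Finset (ℤ × ℤ)} {h₀ : L2 L₁ L₂}
  {ζ : Lp (HperDual L₁ L₂ 2) 2 (timeMeasure T)} {h : ℝ → PerSmooth L₁ L₂}

/-- Every linear image of a Galerkin solution inherits its absolute continuity, since linear maps on
`H_N` are continuous. -/
theorem IsGalerkinSolution.absCont_linear (hs : IsGalerkinSolution γ ε Φ T I h₀ ζ h)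
    (hL₁ : 0 < L₁) (hL₂ : 0 < L₂) (hT : 0 ≤ T) {F : Type*} [NormedAddCommGroup F]
    [NormedSpace ℝ F] (S : PerSmooth L₁ L₂ →ₗ[ℝ] F) :
    AbsolutelyContinuousOnInterval (fun t => S (h t)) 0 T := by
  obtain ⟨A, hA⟩ := exists_clm_eq_on_trigSpace hL₁ hL₂ I S
  refine absolutelyContinuousOnInterval_of_dist_le (C := ‖A‖) hs.absCont fun s hs' t ht => ?_
  rw [uIcc_of_le hT] at hs' ht
  rw [dist_eq_norm, dist_eq_norm, ← hA _ (hs.mem s hs'), ← hA _ (hs.mem t ht), ← map_sub]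
  exact A.le_opNorm _

theorem IsGalerkinSolution.continuousOn_linear (hs : IsGalerkinSolution γ ε Φ T I h₀ ζ h)
    (hL₁ : 0 < L₁) (hL₂ : 0 < L₂) (hT : 0 ≤ T) {F : Type*} [NormedAddCommGroup F]
    [NormedSpace ℝ F] (S : PerSmooth L₁ L₂ →ₗ[ℝ] F) :
    ContinuousOn (fun t => S (h t)) (Icc 0 T) := by
  rw [← uIcc_of_le hT]
  exact (hs.absCont_linear hL₁ hL₂ hT S).continuousOn

theorem IsGalerkinSolution.aestronglyMeasurable (hs : IsGalerkinSolution γ ε Φ T I h₀ ζ h)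
    (hL₁ : 0 < L₁) (hL₂ : 0 < L₂) (hT : 0 ≤ T) {F : Type*} [NormedAddCommGroup F]
    [NormedSpace ℝ F] (S : PerSmooth L₁ L₂ →ₗ[ℝ] F) :
    AEStronglyMeasurable (fun t => S (h t)) (timeMeasure T) :=
  ((hs.continuousOn_linear hL₁ hL₂ hT S).mono Ioo_subset_Icc_self).aestronglyMeasurable
    measurableSet_Ioo

theorem IsGalerkinSolution.integrable_norm_sq (hs : IsGalerkinSolution γ ε Φ T I h₀ ζ h)
    (hL₁ : 0 < L₁) (hL₂ : 0 < L₂) (hT : 0 ≤ T) {F : Type*} [NormedAddCommGroup F]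
    [NormedSpace ℝ F] (S : PerSmooth L₁ L₂ →ₗ[ℝ] F) :
    Integrable (fun t => ‖S (h t)‖ ^ 2) (timeMeasure T) :=
  (((hs.continuousOn_linear hL₁ hL₂ hT S).norm.pow 2).integrableOn_compact isCompact_Icc).mono_set
    Ioo_subset_Icc_self

theorem IsGalerkinSolution.hasDerivAt_linear (hs : IsGalerkinSolution γ ε Φ T I h₀ ζ h)
    (hL₁ : 0 < L₁) (hL₂ : 0 < L₂) {F : Type*} [NormedAddCommGroup F]
    [NormedSpace ℝ F] (S : PerSmooth L₁ L₂ →ₗ[ℝ] F) {t : ℝ} (ht : t ∈ Ioo 0 T)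
    {ψ : PerSmooth L₁ L₂} (hψ : ψ ∈ trigSpace L₁ L₂ I)
    (hd : HasDerivAt (fun t => toL2 (h t)) (toL2 ψ) t) :
    HasDerivAt (fun t => S (h t)) (S ψ) t := by
  obtain ⟨A, hA⟩ := exists_clm_eq_on_trigSpace hL₁ hL₂ I S
  have h1 : HasDerivAt (fun t => A (toL2 (h t))) (A (toL2 ψ)) t :=
    A.hasFDerivAt.comp_hasDerivAt t hd
  rw [hA ψ hψ] at h1
  refine h1.congr_of_eventuallyEq ?_
  filter_upwards [Ioo_mem_nhds ht.1 ht.2] with s hs'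
  exact (hA _ (hs.mem s (Ioo_subset_Icc_self hs'))).symm

/-- Against test functions in `H_N` the projection of the initial datum can be dropped. -/
theorem IsGalerkinSolution.inner_init (hs : IsGalerkinSolution γ ε Φ T I h₀ ζ h)
    {φ : PerSmooth L₁ L₂} (hφ : φ ∈ trigSpace L₁ L₂ I) :
    inner ℝ (toL2 (h 0)) (toL2 φ) = inner ℝ h₀ (toL2 φ) := by
  rw [hs.init, proj, Submodule.inner_starProjection_left_eq_right,
    Submodule.starProjection_eq_self_iff.2 (Submodule.mem_map_of_mem hφ)]

theorem IsGalerkinSolution.norm_init_le (hs : IsGalerkinSolution γ ε Φ T I h₀ ζ h) :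
    ‖toL2 (h 0)‖ ≤ ‖h₀‖ := by
  rw [hs.init, proj]
  exact Submodule.norm_starProjection_apply_le _ _

/-- The energy estimate obtained by testing with `h` itself. -/
theorem IsGalerkinSolution.energy_estimate (hs : IsGalerkinSolution γ ε Φ T I h₀ ζ h)
    (hL₁ : 0 < L₁) (hL₂ : 0 < L₂) (hT : 0 < T) (hγ : 0 ≤ γ) (hε : 0 < ε) {M : ℝ} (hM : 0 ≤ M)
    (hΦ : FluxLipschitz Φ M) :
    ∀ t ∈ Icc 0 T, ‖toL2 (h t)‖ ^ 2 + ∫ s in Ioo 0 t, ε ^ 2 * ‖toL2 (lap (h s))‖ ^ 2 ≤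
      Real.exp ((1 + 8 * M ^ 2 / ε ^ 2) * T) * (‖h₀‖ ^ 2 + (9 + 18 / ε ^ 2) * ‖ζ‖ ^ 2) := by
  intro t ht
  have hae : ∀ᵐ t ∂volume.restrict (Ioo 0 T),
      deriv (fun t => ‖toL2 (h t)‖ ^ 2) t + ε ^ 2 * ‖toL2 (lap (h t))‖ ^ 2 ≤
        (1 + 8 * M ^ 2 / ε ^ 2) * ‖toL2 (h t)‖ ^ 2 + (9 + 18 / ε ^ 2) * ‖ζ t‖ ^ 2 := by
    filter_upwards [hs.hasDerivAt] with t h1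
    obtain ⟨-, hm, ψ, hψ, hd, he⟩ := h1
    rw [hd.norm_sq.deriv, real_inner_comm, he _ hm, aForm_eq, real_inner_self_eq_norm_sq]
    have h1 := abs_fluxForm_self_le hM hΦ (h t)
    have h2 := norm_grad_sq (h t)
    rw [← inner_lap_comm] at h2
    have h3 : ζ t (toHper 2 (h t)) ≤ ‖ζ t‖ * ‖toHper 2 (h t)‖ :=
      (le_abs_self _).trans ((ζ t).le_opNorm _)
    have h4 := norm_toHper_two_sq_le (h t)
    set a := ‖toL2 (h t)‖
    set b := ‖toL2 (lap (h t))‖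
    set z := ‖ζ t‖
    have ha : 0 ≤ a := norm_nonneg _
    have hb : 0 ≤ b := norm_nonneg _
    have hz : 0 ≤ z := norm_nonneg (ζ t)
    have h5 : ‖toHper 2 (h t)‖ ≤ 3 * (a + b) :=
      le_of_abs_le (abs_le_of_sq_le_sq (h4.trans (by nlinarith [mul_nonneg ha hb])) (by positivity))
    have h6 : 0 ≤ γ * -inner ℝ (toL2 (lap (h t))) (toL2 (h t)) := by
      rw [← h2]; positivity
    have h7 := (le_abs_self _).trans h1
    have h8 : ζ t (toHper 2 (h t)) ≤ z * (3 * (a + b)) := h3.trans (by gcongr)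
    -- Young's inequality for `6 z b` and `4 M a b`.
    have y1 : 6 * z * b ≤ ε ^ 2 / 2 * b ^ 2 + 18 / ε ^ 2 * z ^ 2 := by
      have : ε ^ 2 / 2 * b ^ 2 + 18 / ε ^ 2 * z ^ 2 - 6 * z * b = (ε * b - 6 * z / ε) ^ 2 / 2 := by
        field_simp; ring
      nlinarith [sq_nonneg (ε * b - 6 * z / ε)]
    have y2 : 4 * M * a * b ≤ ε ^ 2 / 2 * b ^ 2 + 8 * M ^ 2 / ε ^ 2 * a ^ 2 := by
      have : ε ^ 2 / 2 * b ^ 2 + 8 * M ^ 2 / ε ^ 2 * a ^ 2 - 4 * M * a * b =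
          (ε * b - 4 * M * a / ε) ^ 2 / 2 := by
        field_simp; ring
      nlinarith [sq_nonneg (ε * b - 4 * M * a / ε)]
    nlinarith [sq_nonneg (a - 3 * z)]
  have hζ := integrable_norm_sq_Lp ζ
  have h1 := energy_gronwall hT.le (by positivity : (0 : ℝ) ≤ 1 + 8 * M ^ 2 / ε ^ 2)
    (absolutelyContinuousOnInterval_norm_sq hs.absCont) (fun t _ => sq_nonneg _)
    ((hs.integrable_norm_sq hL₁ hL₂ hT.le (toL2 ∘ₗ lap)).const_mul (ε ^ 2))
    (fun t => by positivity) (hζ.const_mul (9 + 18 / ε ^ 2)) (fun t => by positivity) hae t ht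
  refine h1.trans ?_
  have h2 : ∫ s in Ioo 0 T, (9 + 18 / ε ^ 2) * ‖ζ s‖ ^ 2 = (9 + 18 / ε ^ 2) * ‖ζ‖ ^ 2 := by
    rw [integral_const_mul, ← integral_norm_sq_Lp]; rfl
  rw [h2]
  gcongr
  exact hs.norm_init_le

end

theorem Hper_toL2_toHper (m : ℕ) (φ : PerSmooth L₁ L₂) : Hper.toL2 m (toHper m φ) = toL2 φ := by
  change toL2 (D (0, 0) φ) = toL2 φ
  simp [D]

section

variable {γ ε T : ℝ} {Φ : ℝ → ℝ} {I : Finset (ℤ × ℤ)} {h₀ : Hper L₁ L₂ 2}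
  {ζ : Lp (L2 L₁ L₂) 2 (timeMeasure T)} {h : ℝ → PerSmooth L₁ L₂}

/-- The discrete initial value is bounded in `H²`: both the projection and the weak derivative are
moved onto `Δ h(0) ∈ H_N`. -/
theorem IsGalerkinSolution.norm_lap_init_le
    (hs : IsGalerkinSolution γ ε Φ T I (Hper.toL2 2 h₀) (embedSource T ζ) h) (hT : 0 ≤ T) :
    ‖toL2 (lap (h 0))‖ ≤ 2 * ‖h₀‖ := by
  have hm : h 0 ∈ trigSpace L₁ L₂ I := hs.mem 0 ⟨le_rfl, hT⟩
  set g := lap (h 0) with hg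
  have h1 : ‖toL2 g‖ * ‖toL2 g‖ = inner ℝ (h₀.1 (zeroIdx 2)) (toL2 (lap g)) := by
    rw [← real_inner_self_eq_norm_mul_norm]
    nth_rewrite 1 [hg]
    rw [inner_lap_comm, hs.inner_init (lap_mem_trigSpace (lap_mem_trigSpace hm))]
    rfl
  have h2 := h₀.2 ⟨(2, 0), by decide⟩ g
  have h3 := h₀.2 ⟨(0, 2), by decide⟩ g
  norm_num at h2 h3
  rw [lap, LinearMap.add_apply, map_add, inner_add_right] at h1
  have h4 := real_inner_le_norm (h₀.1 ⟨(2, 0), by decide⟩) (toL2 g)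
  have h5 := real_inner_le_norm (h₀.1 ⟨(0, 2), by decide⟩) (toL2 g)
  have h6 := norm_Hper_apply_le h₀ ⟨(2, 0), by decide⟩
  have h7 := norm_Hper_apply_le h₀ ⟨(0, 2), by decide⟩
  rcases (norm_nonneg (toL2 g)).eq_or_lt with h0 | h0
  · rw [← h0]; positivity
  · refine le_of_mul_le_mul_right ?_ h0
    rw [h1, h2, h3]
    nlinarith

/-- For a source in `L²(0,T;L²(Ω))` the duality pairing is the `L²` inner product. -/
theorem IsGalerkinSolution.hasDerivAt_of_source
    (hs : IsGalerkinSolution γ ε Φ T I (Hper.toL2 2 h₀) (embedSource T ζ) h) :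
    ∀ᵐ t ∂timeMeasure T, t ∈ Ioo 0 T ∧ h t ∈ trigSpace L₁ L₂ I ∧
      ∃ ψ ∈ trigSpace L₁ L₂ I, HasDerivAt (fun t => toL2 (h t)) (toL2 ψ) t ∧
        ∀ φ ∈ trigSpace L₁ L₂ I,
          inner ℝ (toL2 ψ) (toL2 φ) = inner ℝ (ζ t) (toL2 φ) - aForm γ ε Φ (h t) φ := by
  have hζ : ∀ᵐ t ∂timeMeasure T, embedSource T ζ t = l2ToDual 2 (ζ t) := by
    filter_upwards [ContinuousLinearMap.coeFn_compLp (𝕜 := ℝ) (𝕜' := ℝ) (σ := RingHom.id ℝ)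
      (E := L2 L₁ L₂) (F := HperDual L₁ L₂ 2) (l2ToDual 2) ζ] with t ht using ht
  filter_upwards [hs.hasDerivAt, hζ] with t h1 h2
  obtain ⟨ht, hm, ψ, hψ, hd, he⟩ := h1
  refine ⟨ht, hm, ψ, hψ, hd, fun φ hφ => ?_⟩
  rw [he φ hφ, h2, l2ToDual_apply, Hper_toL2_toHper]

/-- The energy estimate obtained by testing with `Δ² h`. -/
theorem IsGalerkinSolution.energy_estimate_lap
    (hs : IsGalerkinSolution γ ε Φ T I (Hper.toL2 2 h₀) (embedSource T ζ) h)
    (hL₁ : 0 < L₁) (hL₂ : 0 < L₂) (hT : 0 < T) (hγ : 0 ≤ γ) (hε : 0 < ε) {M : ℝ} (hM : 0 ≤ M)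
    (hΦ : FluxLipschitz Φ M) :
    ∀ t ∈ Icc 0 T,
      ‖toL2 (lap (h t))‖ ^ 2 + ∫ s in Ioo 0 t, ε ^ 2 * ‖toL2 (lap (lap (h s)))‖ ^ 2 ≤
      Real.exp ((2 * (γ + 4 * M) ^ 2 / ε ^ 2) * T)
        * ((2 * ‖h₀‖) ^ 2 + 2 / ε ^ 2 * ‖ζ‖ ^ 2) := by
  intro t ht
  have hae : ∀ᵐ t ∂volume.restrict (Ioo 0 T),
      deriv (fun t => ‖toL2 (lap (h t))‖ ^ 2) t + ε ^ 2 * ‖toL2 (lap (lap (h t)))‖ ^ 2 ≤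
        (2 * (γ + 4 * M) ^ 2 / ε ^ 2) * ‖toL2 (lap (h t))‖ ^ 2 + 2 / ε ^ 2 * ‖ζ t‖ ^ 2 := by
    filter_upwards [hs.hasDerivAt_of_source] with t h1
    obtain ⟨ht, hm, ψ, hψ, hd, he⟩ := h1
    have hd' : HasDerivAt (fun t => toL2 (lap (h t))) (toL2 (lap ψ)) t :=
      hs.hasDerivAt_linear hL₁ hL₂ (toL2 ∘ₗ lap) ht hψ hd
    rw [hd'.norm_sq.deriv, real_inner_comm, inner_lap_comm,
      he _ (lap_mem_trigSpace (lap_mem_trigSpace hm)), aForm_eq,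
      ← inner_lap_comm (lap (h t)) (lap (lap (h t))),
      real_inner_self_eq_norm_sq]
    have h1 := abs_fluxForm_le hL₁ hL₂ hM hΦ (h t) (lap (lap (h t)))
    have h2 := real_inner_le_norm (ζ t) (toL2 (lap (lap (h t))))
    have h3 := real_inner_le_norm (toL2 (lap (h t))) (toL2 (lap (lap (h t))))
    set b := ‖toL2 (lap (h t))‖
    set c := ‖toL2 (lap (lap (h t)))‖
    set z := ‖ζ t‖
    have h4 := mul_le_mul_of_nonneg_left h3 hγ
    have h7 := (le_abs_self _).trans h1
    -- Young's inequality for `2 z c` and `2 (γ + 4 M) b c`.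
    have y1 : 2 * z * c ≤ ε ^ 2 / 2 * c ^ 2 + 2 / ε ^ 2 * z ^ 2 := by
      have : ε ^ 2 / 2 * c ^ 2 + 2 / ε ^ 2 * z ^ 2 - 2 * z * c = (ε * c - 2 * z / ε) ^ 2 / 2 := by
        field_simp; ring
      nlinarith [sq_nonneg (ε * c - 2 * z / ε)]
    have y2 : 2 * (γ + 4 * M) * b * c ≤
        ε ^ 2 / 2 * c ^ 2 + 2 * (γ + 4 * M) ^ 2 / ε ^ 2 * b ^ 2 := by
      have : ε ^ 2 / 2 * c ^ 2 + 2 * (γ + 4 * M) ^ 2 / ε ^ 2 * b ^ 2 - 2 * (γ + 4 * M) * b * c =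
          (ε * c - 2 * (γ + 4 * M) * b / ε) ^ 2 / 2 := by
        field_simp; ring
      nlinarith [sq_nonneg (ε * c - 2 * (γ + 4 * M) * b / ε)]
    linarith
  have hζ := integrable_norm_sq_Lp ζ
  have h1 := energy_gronwall hT.le (by positivity : (0 : ℝ) ≤ 2 * (γ + 4 * M) ^ 2 / ε ^ 2)
    (absolutelyContinuousOnInterval_norm_sq (hs.absCont_linear hL₁ hL₂ hT.le (toL2 ∘ₗ lap)))
    (fun t _ => sq_nonneg _)
    ((hs.integrable_norm_sq hL₁ hL₂ hT.le (toL2 ∘ₗ lap ∘ₗ lap)).const_mul (ε ^ 2))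
    (fun t => by positivity) (hζ.const_mul (2 / ε ^ 2)) (fun t => by positivity) hae t ht
  refine h1.trans ?_
  have h2 : ∫ s in Ioo 0 T, 2 / ε ^ 2 * ‖ζ s‖ ^ 2 = 2 / ε ^ 2 * ‖ζ‖ ^ 2 := by
    rw [integral_const_mul, ← integral_norm_sq_Lp]; rfl
  rw [h2]
  gcongr
  exact hs.norm_lap_init_le hT.le

/-- The bound for `∂ₜh` obtained by testing with `∂ₜh`; here `⟨Δh, Δ∂ₜh⟩ = ⟨Δ²h, ∂ₜh⟩`. -/
theorem IsGalerkinSolution.norm_deriv_sq_le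
    (hs : IsGalerkinSolution γ ε Φ T I (Hper.toL2 2 h₀) (embedSource T ζ) h)
    (hL₁ : 0 < L₁) (hL₂ : 0 < L₂) (hγ : 0 ≤ γ) {M : ℝ} (hM : 0 ≤ M)
    (hΦ : FluxLipschitz Φ M) :
    ∀ᵐ t ∂timeMeasure T, ‖deriv (fun t => toL2 (h t)) t‖ ^ 2 ≤
      3 * (‖ζ t‖ ^ 2 + (γ + 4 * M) ^ 2 * ‖toL2 (lap (h t))‖ ^ 2
        + ε ^ 4 * ‖toL2 (lap (lap (h t)))‖ ^ 2) := by
  filter_upwards [hs.hasDerivAt_of_source] with t h1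
  obtain ⟨ht, hm, ψ, hψ, hd, he⟩ := h1
  rw [hd.deriv]
  have h0 := he ψ hψ
  rw [aForm_eq, ← inner_lap_comm (lap (h t)), real_inner_self_eq_norm_mul_norm] at h0
  have h1 := (le_abs_self _).trans (abs_fluxForm_le hL₁ hL₂ hM hΦ (h t) ψ)
  have h2 := real_inner_le_norm (ζ t) (toL2 ψ)
  have h3 := mul_le_mul_of_nonneg_left (real_inner_le_norm (toL2 (lap (h t))) (toL2 ψ)) hγ
  have h4 := mul_le_mul_of_nonneg_left (neg_le_of_abs_le
    (abs_real_inner_le_norm (toL2 (lap (lap (h t)))) (toL2 ψ))) (sq_nonneg ε)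
  set b := ‖toL2 (lap (h t))‖
  set c := ‖toL2 (lap (lap (h t)))‖
  set z := ‖ζ t‖
  set y := ‖toL2 ψ‖
  have hb : 0 ≤ b := norm_nonneg _
  have hc : 0 ≤ c := norm_nonneg _
  have hz : 0 ≤ z := norm_nonneg _
  have hy : y ≤ z + (γ + 4 * M) * b + ε ^ 2 * c := by
    rcases (norm_nonneg _ : 0 ≤ y).eq_or_lt with h0' | h0'
    · exact h0'.symm.le.trans (by positivity)
    · refine le_of_mul_le_mul_right ?_ h0'
      linarith
  calc y ^ 2 ≤ (z + (γ + 4 * M) * b + ε ^ 2 * c) ^ 2 :=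
        pow_le_pow_left₀ (norm_nonneg _) hy 2
    _ ≤ _ := by
        nlinarith [sq_nonneg (z - (γ + 4 * M) * b), sq_nonneg (z - ε ^ 2 * c),
          sq_nonneg ((γ + 4 * M) * b - ε ^ 2 * c)]

end

/-! ### Bounds in the Bochner norms -/

section

variable {γ ε T : ℝ} {Φ : ℝ → ℝ} {I : Finset (ℤ × ℤ)}

/-- The norms of `L^∞(0,T;L²)` and `L²(0,T;H²)` in terms of a bound `Q` for the energy. -/
theorem IsGalerkinSolution.bounds {h₀ : L2 L₁ L₂}
    {ζ : Lp (HperDual L₁ L₂ 2) 2 (timeMeasure T)} {h : ℝ → PerSmooth L₁ L₂}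
    (hs : IsGalerkinSolution γ ε Φ T I h₀ ζ h)
    (hL₁ : 0 < L₁) (hL₂ : 0 < L₂) (hT : 0 < T) (hε : 0 < ε) {Q : ℝ}
    (hQ : ∀ t ∈ Icc 0 T, ‖toL2 (h t)‖ ^ 2 + ∫ s in Ioo 0 t, ε ^ 2 * ‖toL2 (lap (h s))‖ ^ 2 ≤ Q) :
    (MemLp (fun t => toL2 (h t)) ⊤ (timeMeasure T) ∧
      eLpNorm (fun t => toL2 (h t)) ⊤ (timeMeasure T) ≤ ENNReal.ofReal (Real.sqrt Q)) ∧
    (MemLp (fun t => toHper 2 (h t)) 2 (timeMeasure T) ∧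
      eLpNorm (fun t => toHper 2 (h t)) 2 (timeMeasure T) ≤
        ENNReal.ofReal (Real.sqrt (6 * (T * Q + Q / ε ^ 2)))) := by
  have h1 : ∀ t ∈ Icc 0 T, ‖toL2 (h t)‖ ^ 2 ≤ Q := fun t ht =>
    (le_add_of_nonneg_right (integral_nonneg fun _ => by positivity)).trans (hQ t ht)
  have h2 : ∫ s in Ioo 0 T, ‖toL2 (lap (h s))‖ ^ 2 ≤ Q / ε ^ 2 := by
    rw [le_div_iff₀ (by positivity), mul_comm, ← integral_const_mul]
    exact (le_add_of_nonneg_left (sq_nonneg _)).trans (hQ T ⟨hT.le, le_rfl⟩)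
  have hi : Integrable (fun t => ‖toL2 (lap (h t))‖ ^ 2) (timeMeasure T) :=
    hs.integrable_norm_sq hL₁ hL₂ hT.le (toL2 ∘ₗ lap)
  refine ⟨eLpNorm_top_le_sqrt (hs.aestronglyMeasurable hL₁ hL₂ hT.le toL2) ?_,
    eLpNorm_two_le_sqrt (hs.aestronglyMeasurable hL₁ hL₂ hT.le (toHper 2))
      (w := fun t => 6 * (Q + ‖toL2 (lap (h t))‖ ^ 2))
      (((integrable_const Q).add hi).const_mul 6) ?_ ?_⟩
  · filter_upwards [ae_restrict_mem measurableSet_Ioo] with t ht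
    exact h1 t (Ioo_subset_Icc_self ht)
  · filter_upwards [ae_restrict_mem measurableSet_Ioo] with t ht
    exact (norm_toHper_two_sq_le _).trans (by gcongr; exact h1 t (Ioo_subset_Icc_self ht))
  · rw [integral_const_mul, integral_add (integrable_const Q) hi]
    simp only [timeMeasure, integral_const, smul_eq_mul, measureReal_restrict_apply_univ,
      Real.volume_real_Ioo_of_le hT.le, sub_zero]
    gcongr

/-- The norms of `L^∞(0,T;H²)`, `L²(0,T;H⁴)` and of `∂ₜh` in `L²(0,T;L²)` in terms of bounds `Q` for
`‖h‖²` and `R` for the energy of `Δh`. -/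
theorem IsGalerkinSolution.regularity_bounds {h₀ : Hper L₁ L₂ 2}
    {ζ : Lp (L2 L₁ L₂) 2 (timeMeasure T)} {h : ℝ → PerSmooth L₁ L₂}
    (hs : IsGalerkinSolution γ ε Φ T I (Hper.toL2 2 h₀) (embedSource T ζ) h)
    (hL₁ : 0 < L₁) (hL₂ : 0 < L₂) (hT : 0 < T) (hγ : 0 ≤ γ) (hε : 0 < ε) {M : ℝ} (hM : 0 ≤ M)
    (hΦ : FluxLipschitz Φ M) {Q R : ℝ} (hQ : ∀ t ∈ Icc 0 T, ‖toL2 (h t)‖ ^ 2 ≤ Q)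
    (hR : ∀ t ∈ Icc 0 T,
      ‖toL2 (lap (h t))‖ ^ 2 + ∫ s in Ioo 0 t, ε ^ 2 * ‖toL2 (lap (lap (h s)))‖ ^ 2 ≤ R) :
    (MemLp (fun t => toHper 2 (h t)) ⊤ (timeMeasure T) ∧
      eLpNorm (fun t => toHper 2 (h t)) ⊤ (timeMeasure T) ≤
        ENNReal.ofReal (Real.sqrt (6 * (Q + R)))) ∧
    (MemLp (fun t => toHper 4 (h t)) 2 (timeMeasure T) ∧
      eLpNorm (fun t => toHper 4 (h t)) 2 (timeMeasure T) ≤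
        ENNReal.ofReal (Real.sqrt (45 * (T * Q + R / ε ^ 2)))) ∧
    (MemLp (deriv fun t => toL2 (h t)) 2 (timeMeasure T) ∧
      eLpNorm (deriv fun t => toL2 (h t)) 2 (timeMeasure T) ≤
        ENNReal.ofReal (Real.sqrt
          (3 * (‖ζ‖ ^ 2 + T * ((γ + 4 * M) ^ 2 * R) + ε ^ 4 * (R / ε ^ 2))))) := by
  have h1 : ∀ t ∈ Icc 0 T, ‖toL2 (lap (h t))‖ ^ 2 ≤ R := fun t ht =>
    (le_add_of_nonneg_right (integral_nonneg fun _ => by positivity)).trans (hR t ht)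
  have h2 : ∫ s in Ioo 0 T, ‖toL2 (lap (lap (h s)))‖ ^ 2 ≤ R / ε ^ 2 := by
    rw [le_div_iff₀ (by positivity), mul_comm, ← integral_const_mul]
    exact (le_add_of_nonneg_left (sq_nonneg _)).trans (hR T ⟨hT.le, le_rfl⟩)
  have hi : Integrable (fun t => ‖toL2 (lap (lap (h t)))‖ ^ 2) (timeMeasure T) :=
    hs.integrable_norm_sq hL₁ hL₂ hT.le (toL2 ∘ₗ lap ∘ₗ lap)
  have hζ := integrable_norm_sq_Lp ζ
  refine ⟨eLpNorm_top_le_sqrt (hs.aestronglyMeasurable hL₁ hL₂ hT.le (toHper 2)) ?_,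
    eLpNorm_two_le_sqrt (hs.aestronglyMeasurable hL₁ hL₂ hT.le (toHper 4))
      (w := fun t => 45 * (Q + ‖toL2 (lap (lap (h t)))‖ ^ 2))
      (((integrable_const Q).add hi).const_mul 45) ?_ ?_,
    eLpNorm_two_le_sqrt (aestronglyMeasurable_deriv _ _)
      (w := fun t => 3 * (‖ζ t‖ ^ 2 + (γ + 4 * M) ^ 2 * R
        + ε ^ 4 * ‖toL2 (lap (lap (h t)))‖ ^ 2))
      (((hζ.add (integrable_const _)).add (hi.const_mul _)).const_mul 3) ?_ ?_⟩
  · filter_upwards [ae_restrict_mem measurableSet_Ioo] with t ht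
    have ht' := Ioo_subset_Icc_self ht
    exact (norm_toHper_two_sq_le _).trans (by gcongr; exacts [hQ t ht', h1 t ht'])
  · filter_upwards [ae_restrict_mem measurableSet_Ioo] with t ht
    exact (norm_toHper_four_sq_le _).trans (by gcongr; exact hQ t (Ioo_subset_Icc_self ht))
  · rw [integral_const_mul, integral_add (integrable_const Q) hi]
    simp only [timeMeasure, integral_const, smul_eq_mul, measureReal_restrict_apply_univ,
      Real.volume_real_Ioo_of_le hT.le, sub_zero]
    gcongr
  · filter_upwards [hs.norm_deriv_sq_le hL₁ hL₂ hγ hM hΦ, ae_restrict_mem measurableSet_Ioo]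
      with t hd ht
    exact hd.trans (by gcongr; exact h1 t (Ioo_subset_Icc_self ht))
  · rw [integral_const_mul, integral_add (hζ.fun_add (integrable_const _)) (hi.const_mul _),
      integral_add hζ (integrable_const _), integral_norm_sq_Lp]
    have h3 : ∫ s in Ioo 0 T, ε ^ 4 * ‖toL2 (lap (lap (h s)))‖ ^ 2 ≤ ε ^ 4 * (R / ε ^ 2) := by
      rw [integral_const_mul]; gcongr
    simp only [timeMeasure, integral_const, smul_eq_mul, measureReal_restrict_apply_univ,
      Real.volume_real_Ioo_of_le hT.le, sub_zero]
    gcongr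

end

end ThinFilm

end

theorem mainTheorem4 (L₁ L₂ T γ ε α p q : ℝ) (hL₁ : 0 < L₁) (hL₂ : 0 < L₂) (hT : 0 < T)
    (hγ : 0 ≤ γ) (hε : 0 < ε) (hα : 0 < α) (hp : 0 < p) (hpq : p < q) (k : ThinFilm.ESModel)
    (I : ℕ → Finset (ℤ × ℤ)) (hI : I = ThinFilm.quadrantFreq ∨ I = ThinFilm.squareFreq) :
    (∀ N : ℕ, 1 ≤ N → ∀ (h₀ : ThinFilm.L2 L₁ L₂)
      (ζ : Lp (ThinFilm.HperDual L₁ L₂ 2) 2 (ThinFilm.timeMeasure T)),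
      (∃ h : ℝ → ThinFilm.PerSmooth L₁ L₂,
        ThinFilm.IsGalerkinSolution γ ε (ThinFilm.Phi k α p q) T (I N) h₀ ζ h) ∧
      ∀ h g : ℝ → ThinFilm.PerSmooth L₁ L₂,
        ThinFilm.IsGalerkinSolution γ ε (ThinFilm.Phi k α p q) T (I N) h₀ ζ h →
        ThinFilm.IsGalerkinSolution γ ε (ThinFilm.Phi k α p q) T (I N) h₀ ζ g →
        ∀ t ∈ Icc 0 T, h t = g t) ∧
    (∃ C : ℝ → ℝ → ℝ, (∀ a b, 0 < C a b) ∧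
      ∀ N : ℕ, 1 ≤ N → ∀ (h₀ : ThinFilm.L2 L₁ L₂)
        (ζ : Lp (ThinFilm.HperDual L₁ L₂ 2) 2 (ThinFilm.timeMeasure T))
        (h : ℝ → ThinFilm.PerSmooth L₁ L₂),
        ThinFilm.IsGalerkinSolution γ ε (ThinFilm.Phi k α p q) T (I N) h₀ ζ h →
        MemLp (fun t => ThinFilm.toL2 (h t)) ⊤ (ThinFilm.timeMeasure T) ∧
        MemLp (fun t => ThinFilm.toHper 2 (h t)) 2 (ThinFilm.timeMeasure T) ∧
        eLpNorm (fun t => ThinFilm.toL2 (h t)) ⊤ (ThinFilm.timeMeasure T)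
          + eLpNorm (fun t => ThinFilm.toHper 2 (h t)) 2 (ThinFilm.timeMeasure T)
          ≤ ENNReal.ofReal (C ‖h₀‖ ‖ζ‖)) ∧
    (∃ C : ℝ → ℝ → ℝ, (∀ a b, 0 < C a b) ∧
      ∀ N : ℕ, 1 ≤ N → ∀ (h₀ : ThinFilm.Hper L₁ L₂ 2)
        (ζ : Lp (ThinFilm.L2 L₁ L₂) 2 (ThinFilm.timeMeasure T))
        (h : ℝ → ThinFilm.PerSmooth L₁ L₂),
        ThinFilm.IsGalerkinSolution γ ε (ThinFilm.Phi k α p q) T (I N)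
          (ThinFilm.Hper.toL2 2 h₀) (ThinFilm.embedSource T ζ) h →
        MemLp (fun t => ThinFilm.toHper 2 (h t)) ⊤ (ThinFilm.timeMeasure T) ∧
        MemLp (fun t => ThinFilm.toHper 4 (h t)) 2 (ThinFilm.timeMeasure T) ∧
        MemLp (deriv fun t => ThinFilm.toL2 (h t)) 2 (ThinFilm.timeMeasure T) ∧
        eLpNorm (fun t => ThinFilm.toHper 2 (h t)) ⊤ (ThinFilm.timeMeasure T)
          + eLpNorm (fun t => ThinFilm.toHper 4 (h t)) 2 (ThinFilm.timeMeasure T)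
          + eLpNorm (deriv fun t => ThinFilm.toL2 (h t)) 2 (ThinFilm.timeMeasure T)
          ≤ ENNReal.ofReal (C ‖h₀‖ ‖ζ‖)) := by
  obtain ⟨M, hM, hΦ⟩ := ThinFilm.exists_fluxLipschitz_Phi (α := α) hp hpq k
  -- Bounds for the two energies in terms of the norms of the data.
  let Q : ℝ → ℝ → ℝ := fun a b =>
    Real.exp ((1 + 8 * M ^ 2 / ε ^ 2) * T) * (a ^ 2 + (9 + 18 / ε ^ 2) * b ^ 2)
  let R : ℝ → ℝ → ℝ := fun a b =>
    Real.exp ((2 * (γ + 4 * M) ^ 2 / ε ^ 2) * T) * ((2 * a) ^ 2 + 2 / ε ^ 2 * b ^ 2)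
  refine ⟨fun N _ h₀ ζ => ⟨ThinFilm.exists_isGalerkinSolution hL₁ hL₂ hT γ ε hM hΦ (I N) h₀ ζ,
    fun h g hh hg => hh.unique hL₁ hL₂ hT hM hΦ hg⟩, ?_, ?_⟩
  · refine ⟨fun a b => Real.sqrt (Q a b) + Real.sqrt (6 * (T * Q a b + Q a b / ε ^ 2)) + 1,
      fun a b => by positivity, fun N _ h₀ ζ h hs => ?_⟩
    obtain ⟨⟨m1, n1⟩, m2, n2⟩ :=
      hs.bounds hL₁ hL₂ hT hε (hs.energy_estimate hL₁ hL₂ hT hγ hε hM hΦ)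
    refine ⟨m1, m2, (add_le_add n1 n2).trans ?_⟩
    rw [← ENNReal.ofReal_add (Real.sqrt_nonneg _) (Real.sqrt_nonneg _)]
    exact ENNReal.ofReal_le_ofReal (le_add_of_nonneg_right zero_le_one)
  · let S : ℝ := ‖ThinFilm.embedSource (L₁ := L₁) (L₂ := L₂) T‖
    refine ⟨fun a b => Real.sqrt (6 * (Q a (S * b) + R a b))
      + Real.sqrt (45 * (T * Q a (S * b) + R a b / ε ^ 2))
      + Real.sqrt (3 * (b ^ 2 + T * ((γ + 4 * M) ^ 2 * R a b) + ε ^ 4 * (R a b / ε ^ 2))) + 1,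
      fun a b => by positivity, fun N _ h₀ ζ h hs => ?_⟩
    -- The first energy estimate applies to the source regarded as an element of `H⁻²`.
    have hQ : ∀ t ∈ Icc 0 T, ‖ThinFilm.toL2 (h t)‖ ^ 2 ≤ Q ‖h₀‖ (S * ‖ζ‖) := fun t ht => by
      refine (le_add_of_nonneg_right (integral_nonneg fun _ => by positivity)).trans
        ((hs.energy_estimate hL₁ hL₂ hT hγ hε hM hΦ t ht).trans ?_)
      have h1 : ‖ThinFilm.Hper.toL2 2 h₀‖ ≤ ‖h₀‖ := ThinFilm.norm_Hper_apply_le h₀ _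
      have h2 : ‖ThinFilm.embedSource T ζ‖ ≤ S * ‖ζ‖ := ContinuousLinearMap.le_opNorm _ _
      simp only [Q]
      gcongr
    obtain ⟨⟨m1, n1⟩, ⟨m2, n2⟩, m3, n3⟩ := hs.regularity_bounds hL₁ hL₂ hT hγ hε hM hΦ hQ
      (hs.energy_estimate_lap hL₁ hL₂ hT hγ hε hM hΦ)
    refine ⟨m1, m2, m3, (add_le_add (add_le_add n1 n2) n3).trans ?_⟩
    rw [← ENNReal.ofReal_add (Real.sqrt_nonneg _) (Real.sqrt_nonneg _),
      ← ENNReal.ofReal_add (by positivity) (Real.sqrt_nonneg _)]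
    exact ENNReal.ofReal_le_ofReal (le_add_of_nonneg_right zero_le_one)
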